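/- Let $\alpha_k=\lceil 2^k/k^2\rceil$ for $k\ge 1$. The bubble graph $S$ is the following graph, with edges labelled by $a^{\pm1},b^{\pm1}$. Its vertices are arranged in pairwise disjoint cycles, each having a level $k\ge1$. A cycle of level $k$ has length $2\alpha_k$, carries a distinguished starting vertex, and its middle vertex is the vertex opposite to the starting one; its edges are labelled cyclically by $a$. There is exactly one cycle of level $1$, whose starting vertex is the root $o$. For every cycle $C$ of level $k$ there are exactly two cycles $C',C''$ of level $k+1$ attached to it: the middle vertex of $C$ and the starting vertices of $C'$ and $C''$ form a $3$-cycle labelled cyclically by $b$. All cycles arise in this way, and $b$ fixes every vertex that lies on no such $3$-cycle. Thus $a$ and $b$ define permutations of the vertices of $S$; the bubble group $\Gamma$ is the group generated by them, acting on $S$ from the right, $(x,g)\mapsto x.g$. Let $$G=\mathbb{Z}_2\wr_S\Gamma=\Big(\bigoplus_S\mathbb{Z}_2\Big)\rtimes\Gamma,\qquad (f,g)(f',g')=(f+f'(\,\cdot\,.g),\,gg'),$$ be the permutational wreath product. Let $\mu$ be the law of the switch-walk-switch step $(\ell,1)(0,g)(\ell',1)$, where $g$ is uniform on $\{a,a^{-1},b,b^{-1}\}$,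 the configurations $\ell,\ell'$ vanish off $o$ and have uniform values in $\mathbb{Z}_2$ at $o$, and $g,\ell,\ell'$ are independent. Let $X_n$ be the product of $n$ independent elements of $G$ with law $\mu$ (with $X_0=e$), and put $p_n(e,e)=\mathbb{P}(X_n=e)$. **Theorem.** The group $G$ is finitely generated, $\mu$ is symmetric ($\mu(g^{-1})=\mu(g)$ for all $g\in G$) and finitely supported, and the support of $\mu$ generates $G$. Moreover: 1. $G$ is non-Liouville with respect to $\mu$: there is a nonconstant bounded function $f:G\to\mathbb{R}$ with $f(g)=\sum_{h\in G}f(gh)\mu(h)$ for all $g\in G$. 2. The random walk has positive speed: for the word length $|\cdot|_T$ of every finite generating set $T$ of $G$ there is $c>0$ such that $\mathbb{E}|X_n|_T\ge cn$ for all $n\ge 0$. 3. The upper return probability exponent satisfies $$\overline{\gamma}=\limsup_{n\to\infty}\frac{\log|\log p_{2n}(e,e)|}{\log n}\le\frac12 .$$ In particular there exist a finitely generated group and a symmetric, finitely supported random walk on it that is non-Liouville and has $\overline{\gamma}\le 1/2$. -/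

import Mathlib

noncomputable section

/-! ### Random walks on groups -/

namespace RandomWalk

variable {G : Type*} [Group G]

/-- The law of `X_n = h₁ h₂ ⋯ h_n`, where the `h_i` are independent with law `μ`
(so `X_0 = 1`); `law μ n g` is the `n`-step transition probability from `1` to `g`. -/
def law (μ : PMF G) : ℕ → PMF G
  | 0 => PMF.pure 1
  | n + 1 => (law μ n).bind fun g => μ.map fun h => g * h

/-- The return probability `p_n(e, e)`. -/
def returnProb (μ : PMF G) (n : ℕ) : ℝ := (law μ n 1).toReal

/-- The upper return probability exponent
`limsup_{n → ∞} log |log p_{2n}(e, e)| / log n`, as an extended real number. -/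
def upperReturnExponent (μ : PMF G) : EReal :=
  Filter.limsup
    (fun n : ℕ => ((Real.log |Real.log (returnProb μ (2 * n))| / Real.log n : ℝ) : EReal))
    Filter.atTop

/-- `f` is `μ`-harmonic: `f g = ∑_h f (g h) μ(h)`. -/
def IsHarmonic (μ : PMF G) (f : G → ℝ) : Prop :=
  ∀ g, f g = ∑' h, f (g * h) * (μ h).toReal

/-- The Liouville property with respect to `μ`: every bounded harmonic function is constant. -/
def Liouville (μ : PMF G) : Prop :=
  ∀ f : G → ℝ, (∃ C : ℝ, ∀ g, |f g| ≤ C) → IsHarmonic μ f → ∃ c : ℝ, ∀ g, f g = c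

/-- The word length of `g` with respect to `T ∪ T⁻¹`. -/
def wordLength (T : Set G) (g : G) : ℕ :=
  sInf {n | ∃ l : List G, l.length = n ∧ (∀ x ∈ l, x ∈ T ∨ x⁻¹ ∈ T) ∧ l.prod = g}

/-- Positive speed: the expected word length of `X_n` grows at least linearly in `n`, for the
word metric of every finite generating set. -/
def PositiveSpeed (μ : PMF G) : Prop :=
  ∀ T : Set G, T.Finite → Subgroup.closure T = ⊤ →
    ∃ c : ℝ, 0 < c ∧ ∀ n : ℕ, c * n ≤ ∑' g, (law μ n g).toReal * (wordLength T g : ℝ)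

end RandomWalk

/-! ### Permutational wreath products -/

namespace PermWreath

variable (A : Type*) [AddCommGroup A] (S : Type*) (Γ : Type*) [Group Γ] [MulAction Γ S]

/-- `Γ` acts on finitely supported configurations by `(g • f) x = f (g⁻¹ • x)`. -/
def lampAction : Γ →* MulAut (Multiplicative (S →₀ A)) where
  toFun g := AddEquiv.toMultiplicative (Finsupp.domCongr (MulAction.toPerm g : Equiv.Perm S))
  map_one' := by
    ext f x
    simp [Finsupp.domCongr, Finsupp.equivMapDomain_apply]
  map_mul' g h := by
    ext f x
    simp [Finsupp.domCongr, Finsupp.equivMapDomain_apply, mul_smul]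

end PermWreath

/-- The permutational wreath product `A ≀_S Γ = (⨁_S A) ⋊ Γ` for a commutative (additively
written) lamp group `A`. In terms of the right action `x.g = g⁻¹ • x` of `Γ` on `S`, the product
is `(f, g) (f', g') = (f + (x ↦ f' (x.g)), g g')`. -/
abbrev PermWreath (A : Type*) [AddCommGroup A] (S : Type*) (Γ : Type*) [Group Γ]
    [MulAction Γ S] : Type _ :=
  Multiplicative (S →₀ A) ⋊[PermWreath.lampAction A S Γ] Γ

namespace PermWreath

variable {A : Type*} [AddCommGroup A] {S : Type*} {Γ : Type*} [Group Γ] [MulAction Γ S]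

/-- The product rule, spelled out at a vertex. -/
theorem mul_left_apply (u v : PermWreath A S Γ) (x : S) :
    Multiplicative.toAdd (u * v).left x =
      Multiplicative.toAdd u.left x + Multiplicative.toAdd v.left (u.right⁻¹ • x) := by
  simp [lampAction, Finsupp.domCongr, Finsupp.equivMapDomain_apply, MulAction.toPerm]

/-- The switch at `o`: the element `(f, 1)` with `f o = l` and `f x = 0` for `x ≠ o`. -/
def switch (o : S) (l : A) : PermWreath A S Γ :=
  SemidirectProduct.inl (Multiplicative.ofAdd (Finsupp.single o l))

/-- One step `(l, 1) (0, g) (l', 1)` of the switch-walk-switch random walk: `l`, `l'` are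
independent switches at `o` with values of law `ν`, and `g` is independent of them with
law `μ`. -/
def switchWalkSwitch (o : S) (ν : PMF A) (μ : PMF Γ) : PMF (PermWreath A S Γ) :=
  ν.bind fun l => μ.bind fun g => ν.bind fun l' =>
    PMF.pure (switch o l * SemidirectProduct.inr g * switch o l')

end PermWreath

/-! ### Bubble graphs and bubble groups -/

namespace Bubble

/-- The vertices of the graph `S(α)`. The cycles of level `k ≥ 1` are indexed by the words `w`
of length `k - 1` in two letters (the two cycles of level `k + 1` attached to the cycle `w` are
`false :: w` and `true :: w`), and the cycle `w` consists of the points `⟨w, i⟩` with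
`i ∈ ℤ / 2 α_k`. Its starting point is `⟨w, 0⟩` and its middle point is `⟨w, α_k⟩`. -/
abbrev Vertex (α : ℕ → ℕ) : Type :=
  Σ w : List Bool, ZMod (2 * α (w.length + 1))

variable (α : ℕ → ℕ)

/-- The root, i.e. the starting point of the cycle of the first level. -/
def root : Vertex α := ⟨[], 0⟩

/-- The starting point of the cycle `w`. -/
def start (w : List Bool) : Vertex α := ⟨w, 0⟩

/-- The middle point of the cycle `w`. -/
def middle (w : List Bool) : Vertex α := ⟨w, (α (w.length + 1) : ZMod _)⟩

/-- The generator `a` moves every vertex to the next one on its cycle. -/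
def a : Equiv.Perm (Vertex α) :=
  Equiv.sigmaCongrRight fun _ => Equiv.addRight 1

/-- The map given by `b`: it runs cyclically through the branching cycles
`middle w → start (false :: w) → start (true :: w) → middle w` and fixes all other vertices. -/
def bFun : Vertex α → Vertex α
  | ⟨w, i⟩ =>
    if i = (α (w.length + 1) : ZMod _) then start α (false :: w)
    else if i = 0 then
      match w with
      | [] => start α []
      | false :: v => start α (true :: v)
      | true :: v => middle α v
    else ⟨w, i⟩

/-- The map given by `b⁻¹`. -/
def bInvFun : Vertex α → Vertex α
  | ⟨w, i⟩ =>
    if i = (α (w.length + 1) : ZMod _) then start α (true :: w)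
    else if i = 0 then
      match w with
      | [] => start α []
      | false :: v => middle α v
      | true :: v => start α (false :: v)
    else ⟨w, i⟩

variable {α}

theorem zero_ne_middle (hα : ∀ k, 1 ≤ k → 1 ≤ α k) (k : ℕ) :
    (0 : ZMod (2 * α (k + 1))) ≠ (α (k + 1) : ZMod (2 * α (k + 1))) := by
  intro h
  have h1 := hα (k + 1) (by omega)
  have h2 := (ZMod.natCast_eq_zero_iff (α (k + 1)) (2 * α (k + 1))).1 h.symm
  have h3 := Nat.le_of_dvd h1 h2
  omega

theorem bFun_middle (w : List Bool) : bFun α (middle α w) = start α (false :: w) :=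
  if_pos rfl

theorem bFun_start_false (hα : ∀ k, 1 ≤ k → 1 ≤ α k) (w : List Bool) :
    bFun α (start α (false :: w)) = start α (true :: w) :=
  (if_neg (zero_ne_middle hα _)).trans (if_pos rfl)

theorem bFun_start_true (hα : ∀ k, 1 ≤ k → 1 ≤ α k) (w : List Bool) :
    bFun α (start α (true :: w)) = middle α w :=
  (if_neg (zero_ne_middle hα _)).trans (if_pos rfl)

theorem bFun_root (hα : ∀ k, 1 ≤ k → 1 ≤ α k) : bFun α (root α) = root α :=
  (if_neg (zero_ne_middle hα _)).trans (if_pos rfl)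

theorem bFun_other (w : List Bool) (i : ZMod (2 * α (w.length + 1)))
    (h₁ : i ≠ (α (w.length + 1) : ZMod _)) (h₂ : i ≠ 0) : bFun α ⟨w, i⟩ = ⟨w, i⟩ :=
  (if_neg h₁).trans (if_neg h₂)

theorem bInvFun_middle (w : List Bool) : bInvFun α (middle α w) = start α (true :: w) :=
  if_pos rfl

theorem bInvFun_start_false (hα : ∀ k, 1 ≤ k → 1 ≤ α k) (w : List Bool) :
    bInvFun α (start α (false :: w)) = middle α w :=
  (if_neg (zero_ne_middle hα _)).trans (if_pos rfl)

theorem bInvFun_start_true (hα : ∀ k, 1 ≤ k → 1 ≤ α k) (w : List Bool) :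
    bInvFun α (start α (true :: w)) = start α (false :: w) :=
  (if_neg (zero_ne_middle hα _)).trans (if_pos rfl)

theorem bInvFun_root (hα : ∀ k, 1 ≤ k → 1 ≤ α k) : bInvFun α (root α) = root α :=
  (if_neg (zero_ne_middle hα _)).trans (if_pos rfl)

theorem bInvFun_other (w : List Bool) (i : ZMod (2 * α (w.length + 1)))
    (h₁ : i ≠ (α (w.length + 1) : ZMod _)) (h₂ : i ≠ 0) : bInvFun α ⟨w, i⟩ = ⟨w, i⟩ :=
  (if_neg h₁).trans (if_neg h₂)

/-- Every vertex is the root, a middle point, another starting point, or on no branching cycle. -/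
theorem vertex_cases {P : Vertex α → Prop} (h_root : P (root α))
    (h_middle : ∀ w, P (middle α w)) (h_false : ∀ w, P (start α (false :: w)))
    (h_true : ∀ w, P (start α (true :: w)))
    (h_other : ∀ (w : List Bool) (i : ZMod (2 * α (w.length + 1))),
      i ≠ (α (w.length + 1) : ZMod _) → i ≠ 0 → P ⟨w, i⟩) (x : Vertex α) : P x := by
  obtain ⟨w, i⟩ := x
  by_cases h₁ : i = (α (w.length + 1) : ZMod _)
  · subst h₁
    exact h_middle w
  · by_cases h₂ : i = 0
    · subst h₂
      rcases w with _ | ⟨_ | _, v⟩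
      · exact h_root
      · exact h_false v
      · exact h_true v
    · exact h_other w i h₁ h₂

/-- The generator `b`. -/
def b (hα : ∀ k, 1 ≤ k → 1 ≤ α k) : Equiv.Perm (Vertex α) where
  toFun := bFun α
  invFun := bInvFun α
  left_inv := vertex_cases (by rw [bFun_root hα, bInvFun_root hα])
    (fun w => by rw [bFun_middle, bInvFun_start_false hα])
    (fun w => by rw [bFun_start_false hα, bInvFun_start_true hα])
    (fun w => by rw [bFun_start_true hα, bInvFun_middle])
    (fun w i h₁ h₂ => by rw [bFun_other w i h₁ h₂, bInvFun_other w i h₁ h₂])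
  right_inv := vertex_cases (by rw [bInvFun_root hα, bFun_root hα])
    (fun w => by rw [bInvFun_middle, bFun_start_true hα])
    (fun w => by rw [bInvFun_start_false hα, bFun_middle])
    (fun w => by rw [bInvFun_start_true hα, bFun_start_false hα])
    (fun w i h₁ h₂ => by rw [bInvFun_other w i h₁ h₂, bFun_other w i h₁ h₂])

/-- The bubble group `Γ(α)`: the group of permutations of the vertices generated by `a` and `b`.
It acts on the vertices from the left by evaluation; the corresponding right action is
`x.g = g⁻¹ x`. -/
abbrev BubbleGroup (hα : ∀ k, 1 ≤ k → 1 ≤ α k) : Subgroup (Equiv.Perm (Vertex α)) :=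
  Subgroup.closure {a α, b hα}

/-- `a` as an element of the bubble group. -/
def genA (hα : ∀ k, 1 ≤ k → 1 ≤ α k) : BubbleGroup hα :=
  ⟨a α, Subgroup.subset_closure (by simp)⟩

/-- `b` as an element of the bubble group. -/
def genB (hα : ∀ k, 1 ≤ k → 1 ≤ α k) : BubbleGroup hα :=
  ⟨b hα, Subgroup.subset_closure (by simp)⟩

/-- The step distribution of the simple random walk on the bubble group: each of
`a, a⁻¹, b, b⁻¹` is chosen with probability `1/4`. -/
def simpleStep (hα : ∀ k, 1 ≤ k → 1 ≤ α k) : PMF (BubbleGroup hα) :=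
  (PMF.uniformOfFintype (Fin 4)).map ![genA hα, (genA hα)⁻¹, genB hα, (genB hα)⁻¹]

/-- The scaling sequence `α_k = ⌈2^k / k^2⌉`, `k ≥ 1` (the value at `k = 0` is not used). -/
def scaling (k : ℕ) : ℕ := ⌈(2 : ℚ) ^ k / (k : ℚ) ^ 2⌉₊

theorem one_le_scaling : ∀ k, 1 ≤ k → 1 ≤ scaling k := by
  intro k hk
  have : (0 : ℚ) < k := by exact_mod_cast hk
  exact Nat.one_le_ceil_iff.2 (by positivity)

/-- The Schreier graph `S` (its vertex set) for this scaling sequence. -/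
abbrev S : Type := Vertex scaling

/-- The bubble group `Γ` for this scaling sequence. -/
abbrev Γ : Subgroup (Equiv.Perm S) := BubbleGroup one_le_scaling

/-- The group `G = ℤ₂ ≀_S Γ`. -/
abbrev G : Type := PermWreath (ZMod 2) S Γ

/-- The step distribution on `G` of the switch-walk-switch random walk that is induced by the
simple random walk on `Γ` and the uniform distribution on `ℤ₂`, with switches at the root. -/
def stepLaw : PMF G :=
  PermWreath.switchWalkSwitch (root scaling) (PMF.uniformOfFintype (ZMod 2))
    (simpleStep one_le_scaling)

end Bubble

end

/-!
Harmonic functions and speed come from a potential on the bubble graph: the unit flow from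
the root to infinity that splits evenly at every branching is `2 ^ (-k)` on the edges of level `k`,
so its potential is bounded as soon as `∑ α_k / 2 ^ k < ∞`. It vanishes at the root and is harmonic
elsewhere. Multiplying it by a mean-zero function of one lamp gives a bounded nonconstant harmonic
function on the wreath product, and summing it over the lamps that are on gives a function with
positive drift which is at most a multiple of any word length, whence the positive speed.

For the return probability, confine the exponent sum of `a` along the walk to `[-m, m]`, which up to
time `n` costs a factor `exp (-C n / m ^ 2)`. If the cycles of level greater than `L` have length
larger than `8 m`, then a confined word acts there like on a tripod of three lines joined by a
`b`-cycle, so that a confined element is determined by its exponent sum, by its action on the tripod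
and by its lamps and its action on the about `4 ^ L` vertices of the first `L + 1` levels. By
Cauchy-Schwarz, `p_{2n}(e, e) ≥ P(X_n ∈ E) ^ 2 / |E|` for the set `E` of confined elements. With `n`
of order `16 ^ L` and `m` of order `2 ^ L / L ^ 2` this gives
`|log p_{2n}(e, e)| = O(n ^ (1 / 2) * (log n) ^ 4)`.
-/

/-! ### Laws of random walks -/

namespace RandomWalk

section Mean

variable {α β : Type*} {p : PMF α} {F F' : α → ℝ}

/-- The mean of `F` under the law `p`, used for finitely supported `p`; if the series diverges its
value is `0`. -/
noncomputable def mean (p : PMF α) (F : α → ℝ) : ℝ := ∑' a, (p a).toReal * F a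

theorem mean_const_mul (p : PMF α) (c : ℝ) (F : α → ℝ) :
    mean p (fun a => c * F a) = c * mean p F := by
  simp only [mean, mul_left_comm _ c, tsum_mul_left]

theorem mean_mul_const (p : PMF α) (F : α → ℝ) (c : ℝ) :
    mean p (fun a => F a * c) = mean p F * c := by
  simp only [mean, ← mul_assoc, tsum_mul_right]

theorem mean_const (p : PMF α) (c : ℝ) : mean p (fun _ => c) = c := by
  rw [mean, tsum_mul_right, ← ENNReal.tsum_toReal_eq p.apply_ne_top, p.tsum_coe,
    ENNReal.toReal_one, one_mul]

theorem mean_indicator_finset (p : PMF α) (E : Finset α) :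
    mean p ((E : Set α).indicator 1) = ∑ a ∈ E, (p a).toReal := by
  rw [mean, tsum_eq_sum (s := E) fun a ha => by simp [ha]]
  exact Finset.sum_congr rfl fun a ha => by simp [ha]

theorem mean_pure (a : α) (F : α → ℝ) : mean (PMF.pure a) F = F a := by
  classical
  rw [mean, tsum_eq_single a fun b hb => by simp [hb]]
  simp

theorem mean_uniformOfFintype [Fintype α] [Nonempty α] (F : α → ℝ) :
    mean (PMF.uniformOfFintype α) F = (∑ a, F a) / Fintype.card α := by
  simp [mean, tsum_fintype, Finset.mul_sum, div_eq_inv_mul]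

instance finite_support_pure (a : α) : Finite (PMF.pure a).support := by
  rw [PMF.support_pure]
  infer_instance

instance finite_support_bind [Finite p.support] (q : α → PMF β) [∀ a, Finite (q a).support] :
    Finite (p.bind q).support := by
  rw [PMF.support_bind]
  exact Set.Finite.biUnion (Set.toFinite _) fun a _ => Set.toFinite _

instance finite_support_map [Finite p.support] (f : α → β) : Finite (p.map f).support := by
  rw [PMF.support_map]
  infer_instance

theorem hasSum_mean (p : PMF α) [Finite p.support] (F : α → ℝ) :
    HasSum (fun a => (p a).toReal * F a) (mean p F) := by
  refine (summable_of_hasFiniteSupport (p.support.toFinite.subset fun a ha => ?_)).hasSum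
  rw [PMF.mem_support_iff]
  rintro h
  simp [h] at ha

theorem mean_mono [Finite p.support] (h : ∀ a, F a ≤ F' a) : mean p F ≤ mean p F' :=
  hasSum_le (fun a => mul_le_mul_of_nonneg_left (h a) ENNReal.toReal_nonneg)
    (hasSum_mean p F) (hasSum_mean p F')

theorem mean_add (p : PMF α) [Finite p.support] (F F' : α → ℝ) :
    mean p (fun a => F a + F' a) = mean p F + mean p F' := by
  rw [← ((hasSum_mean p F).add (hasSum_mean p F')).tsum_eq]
  simp only [mean, mul_add]

theorem mean_finset_sum (p : PMF α) [Finite p.support] {ι : Type*} (s : Finset ι)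
    (F : ι → α → ℝ) : mean p (fun a => ∑ i ∈ s, F i a) = ∑ i ∈ s, mean p (F i) := by
  rw [← (hasSum_sum fun i (_ : i ∈ s) => hasSum_mean p (F i)).tsum_eq]
  simp only [mean, Finset.mul_sum]

theorem toReal_bind_apply (p : PMF α) (q : α → PMF β) (b : β) :
    (p.bind q b).toReal = mean p fun a => (q a b).toReal := by
  rw [PMF.bind_apply, ENNReal.tsum_toReal_eq fun a =>
    ENNReal.mul_ne_top (p.apply_ne_top a) ((q a).apply_ne_top b)]
  simp only [ENNReal.toReal_mul, mean]

theorem mean_bind [Finite p.support] (q : α → PMF β) [∀ a, Finite (q a).support] (F : β → ℝ) :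
    mean (p.bind q) F = mean p fun a => mean (q a) F := by
  have mean_eq_sum (F : α → ℝ) :
      mean p F = ∑ a ∈ p.support.toFinite.toFinset, (p a).toReal * F a :=
    tsum_eq_sum fun a ha => by simp_all
  have hsum := hasSum_sum fun a (_ : a ∈ p.support.toFinite.toFinset) =>
    (hasSum_mean (q a) F).mul_left (p a).toReal
  rw [mean_eq_sum, ← hsum.tsum_eq, mean]
  simp only [toReal_bind_apply, mean_eq_sum, Finset.sum_mul, mul_assoc]

theorem mean_map [Finite p.support] (f : α → β) (F : β → ℝ) :
    mean (p.map f) F = mean p fun a => F (f a) := by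
  simp only [PMF.map, Function.comp_def, mean_bind, mean_pure]

end Mean

section Law

variable {G : Type*} [Group G] {μ : PMF G}

theorem law_zero (μ : PMF G) : law μ 0 = PMF.pure 1 := rfl

theorem law_succ (μ : PMF G) (n : ℕ) :
    law μ (n + 1) = (law μ n).bind fun g => μ.map fun h => g * h := rfl

theorem law_add (μ : PMF G) (m n : ℕ) :
    law μ (m + n) = (law μ m).bind fun g => (law μ n).map fun h => g * h := by
  induction n with
  | zero => simp [law_zero, PMF.pure_map, PMF.bind_pure]
  | succ n ih =>
    simp only [← add_assoc, law_succ, ih, PMF.bind_bind, PMF.bind_map, PMF.map_bind, PMF.map_comp,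
      Function.comp_def, mul_assoc]

theorem law_one (μ : PMF G) : law μ 1 = μ := by
  simp only [law_succ, law_zero, PMF.pure_bind, one_mul]
  exact μ.map_id

theorem law_succ' (μ : PMF G) (n : ℕ) :
    law μ (n + 1) = μ.bind fun h => (law μ n).map fun g => h * g := by
  rw [add_comm, law_add, law_one]

instance finite_support_law [Finite μ.support] (n : ℕ) : Finite (law μ n).support := by
  induction n with
  | zero => exact finite_support_pure 1
  | succ n ih => exact finite_support_bind _

theorem mean_law_succ [Finite μ.support] (n : ℕ) (F : G → ℝ) :
    mean (law μ (n + 1)) F = mean (law μ n) fun g => mean μ fun h => F (g * h) := by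
  simp only [law_succ, mean_bind, mean_map]

theorem mean_law_succ' [Finite μ.support] (n : ℕ) (F : G → ℝ) :
    mean (law μ (n + 1)) F = mean μ fun h => mean (law μ n) fun g => F (h * g) := by
  simp only [law_succ', mean_bind, mean_map]

theorem isHarmonic_iff {f : G → ℝ} :
    IsHarmonic μ f ↔ ∀ g, mean μ (fun h => f (g * h)) = f g := by
  simp only [IsHarmonic, mean, mul_comm, eq_comm]

theorem le_mean_law_of_drift [Finite μ.support] {F : G → ℝ} {δ : ℝ}
    (h : ∀ g, F g + δ ≤ mean μ fun h => F (g * h)) (n : ℕ) :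
    F 1 + n * δ ≤ mean (law μ n) F := by
  induction n with
  | zero => simp [law_zero, mean_pure]
  | succ n ih =>
    calc F 1 + (n + 1 : ℕ) * δ = F 1 + n * δ + δ := by push_cast; ring
      _ ≤ mean (law μ n) F + δ := by gcongr
      _ = mean (law μ n) fun g => F g + δ := by rw [mean_add, mean_const]
      _ ≤ mean (law μ (n + 1)) F := by
        rw [mean_law_succ]
        exact mean_mono h

end Law

section ReturnProbability

open Filter Topology

variable {G : Type*} [Group G] {μ : PMF G}

theorem map_equiv_apply {α β : Type*} (p : PMF α) (e : α ≃ β) (b : β) :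
    p.map e b = p (e.symm b) := by
  classical
  rw [PMF.map_apply, tsum_eq_single (e.symm b)]
  · simp
  · rintro a ha
    rw [if_neg]
    rintro rfl
    simp at ha

theorem map_equiv_uniformOfFintype {α : Type*} [Fintype α] [Nonempty α] (e : Equiv.Perm α) :
    (PMF.uniformOfFintype α).map e = PMF.uniformOfFintype α := by
  ext a
  simp only [map_equiv_apply, PMF.uniformOfFintype_apply]

theorem map_mul_left_apply (p : PMF G) (g h : G) : p.map (fun k => g * k) h = p (g⁻¹ * h) :=
  map_equiv_apply p (Equiv.mulLeft g) h

theorem map_inv_eq_self_iff : μ.map (fun g => g⁻¹) = μ ↔ ∀ g, μ g⁻¹ = μ g := by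
  rw [PMF.ext_iff]
  exact forall_congr' fun g => by rw [← show _ = μ g⁻¹ from map_equiv_apply μ (Equiv.inv G) g]; rfl

theorem map_inv_law (hμ : μ.map (fun g => g⁻¹) = μ) (n : ℕ) :
    (law μ n).map (fun g => g⁻¹) = law μ n := by
  induction n with
  | zero => simp [law_zero, PMF.pure_map]
  | succ n ih =>
    calc (law μ (n + 1)).map (fun g => g⁻¹)
        = ((law μ n).map fun g => g⁻¹).bind fun g => (μ.map fun h => h⁻¹).map fun h => h * g := by
          simp only [law_succ, PMF.map_bind, PMF.map_comp, PMF.bind_map, Function.comp_def,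
            mul_inv_rev]
      _ = (law μ n).bind fun g => μ.map fun h => h * g := by rw [ih, hμ]
      _ = law μ (n + 1) := by
          rw [law_succ']
          exact PMF.bind_comm _ _ _

theorem law_two_mul_one (hμ : μ.map (fun g => g⁻¹) = μ) (n : ℕ) :
    law μ (2 * n) 1 = ∑' g, law μ n g ^ 2 := by
  have hsymm := map_inv_eq_self_iff.1 (map_inv_law hμ n)
  simp only [two_mul, law_add, PMF.bind_apply, map_mul_left_apply, mul_one, hsymm, sq]

theorem returnProb_two_mul (hμ : μ.map (fun g => g⁻¹) = μ) (n : ℕ) :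
    HasSum (fun g => (law μ n g).toReal ^ 2) (returnProb μ (2 * n)) := by
  have htop : ∑' g, law μ n g ^ 2 ≠ ⊤ := law_two_mul_one hμ n ▸ PMF.apply_ne_top _ _
  rw [returnProb, law_two_mul_one hμ, ENNReal.tsum_toReal_eq (ENNReal.ne_top_of_tsum_ne_top htop)]
  simpa only [ENNReal.toReal_pow] using ENNReal.hasSum_toReal htop

theorem returnProb_le_one (μ : PMF G) (n : ℕ) : returnProb μ n ≤ 1 :=
  ENNReal.toReal_le_of_le_ofReal zero_le_one (by simpa using PMF.coe_le_one _ _)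

theorem sq_mean_indicator_le (hμ : μ.map (fun g => g⁻¹) = μ) (n : ℕ) (E : Finset G) :
    mean (law μ n) ((E : Set G).indicator 1) ^ 2 ≤ E.card * returnProb μ (2 * n) := by
  rw [mean_indicator_finset]
  refine sq_sum_le_card_mul_sum_sq.trans ?_
  gcongr
  exact sum_le_hasSum E (fun g _ => sq_nonneg _) (returnProb_two_mul hμ n)

theorem abs_log_returnProb_le (hμ : μ.map (fun g => g⁻¹) = μ) (n : ℕ) {E : Set G}
    (hE : E.Finite) {q : ℝ} (hq : 0 < q) (hqE : q ≤ mean (law μ n) (E.indicator 1)) :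
    |Real.log (returnProb μ (2 * n))| ≤ Real.log E.ncard - 2 * Real.log q := by
  lift E to Finset G using hE
  have hle : q ^ 2 ≤ E.card * returnProb μ (2 * n) :=
    (pow_le_pow_left₀ hq.le hqE 2).trans (sq_mean_indicator_le hμ n E)
  have hpos : 0 < E.card * returnProb μ (2 * n) := (pow_pos hq 2).trans_le hle
  have hlog := Real.log_le_log (pow_pos hq 2) hle
  rw [Real.log_mul (left_ne_zero_of_mul hpos.ne') (right_ne_zero_of_mul hpos.ne'),
    Real.log_pow, Nat.cast_ofNat] at hlog
  have hnonpos : Real.log (returnProb μ (2 * n)) ≤ 0 :=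
    Real.log_nonpos ENNReal.toReal_nonneg (returnProb_le_one μ _)
  rw [Set.ncard_coe_finset, abs_of_nonpos hnonpos]
  linarith

theorem tendsto_log_div_log_add (c β : ℝ) (d : ℕ) :
    Tendsto (fun n : ℕ => Real.log c / Real.log n + β + d * (Real.log (Real.log n) / Real.log n))
      atTop (𝓝 β) := by
  have hlog : Tendsto (fun n : ℕ => Real.log n) atTop atTop :=
    Real.tendsto_log_atTop.comp tendsto_natCast_atTop_atTop
  have hloglog : Tendsto (fun n : ℕ => Real.log (Real.log n) / Real.log n) atTop (𝓝 0) :=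
    Real.isLittleO_log_id_atTop.tendsto_div_nhds_zero.comp hlog
  simpa using ((hlog.const_div_atTop _).add_const β).add (hloglog.const_mul (d : ℝ))

theorem log_le_log_of_one_le_right {x y : ℝ} (hx : 0 ≤ x) (hy : 1 ≤ y) (hxy : x ≤ y) :
    Real.log x ≤ Real.log y := by
  rcases hx.eq_or_lt with rfl | hx
  · simpa using Real.log_nonneg hy
  · exact Real.log_le_log hx hxy

theorem upperReturnExponent_le {K β : ℝ} {d : ℕ} (hβ : 0 ≤ β)
    (h : ∀ᶠ n : ℕ in atTop,
      |Real.log (returnProb μ (2 * n))| ≤ K * ((n : ℝ) ^ β * Real.log n ^ d)) :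
    upperReturnExponent μ ≤ (β : EReal) := by
  refine (limsup_le_limsup ?_).trans_eq
    ((continuous_coe_real_ereal.tendsto β).comp (tendsto_log_div_log_add (max K 1) β d)).limsup_eq
  filter_upwards [h, eventually_ge_atTop 1, (Real.tendsto_log_atTop.comp
    tendsto_natCast_atTop_atTop).eventually_ge_atTop 1] with n hn hn1 (hlogn : 1 ≤ Real.log n)
  have hn1' : (1 : ℝ) ≤ n := by exact_mod_cast hn1
  have hlogn0 : 0 < Real.log n := by linarith
  have hlog_bound : Real.log (max K 1 * ((n : ℝ) ^ β * Real.log n ^ d)) =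
      Real.log (max K 1) + (β * Real.log n + d * Real.log (Real.log n)) := by
    rw [Real.log_mul (by positivity) (by positivity), Real.log_mul (by positivity) (by positivity),
      Real.log_rpow (by positivity), Real.log_pow]
  have hone_le : 1 ≤ max K 1 * ((n : ℝ) ^ β * Real.log n ^ d) :=
    one_le_mul_of_one_le_of_one_le (le_max_right _ _) (one_le_mul_of_one_le_of_one_le
      (Real.one_le_rpow hn1' hβ) (one_le_pow₀ hlogn))
  have hle : |Real.log (returnProb μ (2 * n))| ≤ max K 1 * ((n : ℝ) ^ β * Real.log n ^ d) :=
    hn.trans (by gcongr; exact le_max_left _ _)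
  have hloglog_le := log_le_log_of_one_le_right (abs_nonneg _) hone_le hle
  rw [hlog_bound] at hloglog_le
  refine EReal.coe_le_coe_iff.2 ((div_le_iff₀ hlogn0).2 (hloglog_le.trans_eq ?_))
  field_simp
  ring

end ReturnProbability

section WordLength

variable {G : Type*} [Group G] {T : Set G}

theorem exists_list_length_eq_wordLength (hT : Subgroup.closure T = ⊤) (g : G) :
    ∃ l : List G, l.length = wordLength T g ∧ (∀ x ∈ l, x ∈ T ∨ x⁻¹ ∈ T) ∧ l.prod = g := by
  have hg : g ∈ (Subgroup.closure T).toSubmonoid := hT ▸ Subgroup.mem_top g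
  rw [Subgroup.closure_toSubmonoid] at hg
  obtain ⟨l, hl, hprod⟩ := Submonoid.exists_list_of_mem_closure hg
  exact Nat.sInf_mem (s := {n | ∃ l : List G, l.length = n ∧ _}) ⟨l.length, l, rfl, hl, hprod⟩

theorem le_mul_wordLength (hT : Subgroup.closure T = ⊤) {f : G → ℕ} {C : ℕ} (hone : f 1 = 0)
    (hmul : ∀ g h, f (g * h) ≤ f g + f h) (hinv : ∀ g, f g⁻¹ ≤ f g) (hC : ∀ t ∈ T, f t ≤ C)
    (g : G) : f g ≤ C * wordLength T g := by
  obtain ⟨l, hlen, hl, rfl⟩ := exists_list_length_eq_wordLength hT g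
  rw [← hlen]
  clear hlen
  induction l with
  | nil => simp [hone]
  | cons t l ih =>
    have ht : f t ≤ C := by
      rcases hl t List.mem_cons_self with h | h
      · exact hC t h
      · simpa only [inv_inv] using (hinv t⁻¹).trans (hC _ h)
    calc f (t :: l).prod ≤ f t + f l.prod := by rw [List.prod_cons]; exact hmul _ _
      _ ≤ C + C * l.length := add_le_add ht (ih fun x hx => hl x (List.mem_cons_of_mem _ hx))
      _ = C * (t :: l).length := by rw [List.length_cons]; ring

end WordLength

end RandomWalk

/-! ### Switch-walk-switch random walks -/

namespace PermWreath

variable {A : Type*} [AddCommGroup A] {S : Type*} {Γ : Type*} [Group Γ] [MulAction Γ S]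

section Step

/-- The lamp configuration `f` of an element `(f, g)` of a permutational wreath product. -/
abbrev lamps (u : PermWreath A S Γ) : S →₀ A := Multiplicative.toAdd u.left

/-- The increment `(l, 1) (0, g) (l', 1)` of the switch-walk-switch random walk. -/
noncomputable def step (o : S) (l : A) (g : Γ) (l' : A) : PermWreath A S Γ :=
  switch o l * SemidirectProduct.inr g * switch o l'

theorem switch_zero (o : S) : (switch o 0 : PermWreath A S Γ) = 1 := by
  rw [switch, Finsupp.single_zero, ofAdd_zero, map_one]

theorem switch_inv (o : S) (l : A) : (switch o l : PermWreath A S Γ)⁻¹ = switch o (-l) := by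
  rw [switch, switch, ← map_inv, ← ofAdd_neg, ← Finsupp.single_neg]

theorem inr_mul_switch_mul_inr_inv (g : Γ) (o : S) (l : A) :
    (SemidirectProduct.inr g * switch o l * (SemidirectProduct.inr g)⁻¹ : PermWreath A S Γ) =
      switch (g • o) l := by
  rw [switch, switch, ← map_inv, ← SemidirectProduct.inl_aut]
  exact congrArg (SemidirectProduct.inl ∘ Multiplicative.ofAdd)
    (Finsupp.equivMapDomain_single _ _ _)

theorem step_inv (o : S) (l : A) (g : Γ) (l' : A) :
    (step o l g l')⁻¹ = step o (-l') g⁻¹ (-l) := by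
  simp only [step, mul_inv_rev, switch_inv, map_inv, mul_assoc]

theorem mul_step_right (u : PermWreath A S Γ) (o : S) (l : A) (g : Γ) (l' : A) :
    (u * step o l g l').right = u.right * g := by
  simp [step, switch]

theorem lamps_mul_step (u : PermWreath A S Γ) (o : S) (l : A) (g : Γ) (l' : A) (x : S) :
    lamps (u * step o l g l') x =
      lamps u x + Finsupp.single o l (u.right⁻¹ • x) +
        Finsupp.single o l' (g⁻¹ • u.right⁻¹ • x) := by
  simp only [step, ← mul_assoc]
  rw [mul_left_apply, mul_left_apply, mul_left_apply]
  simp [switch, mul_smul]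

end Step

section SwitchWalkSwitch

open RandomWalk

variable {o : S} {ν : PMF A} {μ : PMF Γ}

theorem switchWalkSwitch_eq_bind_step (o : S) (ν : PMF A) (μ : PMF Γ) :
    switchWalkSwitch o ν μ =
      ν.bind fun l => μ.bind fun g => ν.bind fun l' => PMF.pure (step o l g l') := rfl

instance finite_support_switchWalkSwitch (o : S) [Finite ν.support] [Finite μ.support] :
    Finite (switchWalkSwitch o ν μ).support := by
  unfold switchWalkSwitch
  infer_instance

theorem mean_switchWalkSwitch [Finite ν.support] [Finite μ.support] (F : PermWreath A S Γ → ℝ) :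
    mean (switchWalkSwitch o ν μ) F =
      mean ν fun l => mean μ fun g => mean ν fun l' => F (step o l g l') := by
  simp only [switchWalkSwitch_eq_bind_step, mean_bind, mean_pure]

theorem map_inv_switchWalkSwitch (o : S) (hν : ν.map (fun l => -l) = ν)
    (hμ : μ.map (fun g => g⁻¹) = μ) :
    (switchWalkSwitch o ν μ).map (fun u => u⁻¹) = switchWalkSwitch o ν μ :=
  calc (switchWalkSwitch o ν μ).map (fun u => u⁻¹)
      = ν.bind fun l => μ.bind fun g => ν.bind fun l' => PMF.pure (step o (-l') g⁻¹ (-l)) := by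
        simp only [switchWalkSwitch_eq_bind_step, PMF.map_bind, PMF.pure_map, step_inv]
    _ = ν.bind fun l => ν.bind fun l' => μ.bind fun g => PMF.pure (step o (-l') g⁻¹ (-l)) := by
        simp only [PMF.bind_comm μ ν]
    _ = ν.bind fun l' => ν.bind fun l => μ.bind fun g => PMF.pure (step o (-l') g⁻¹ (-l)) :=
        PMF.bind_comm _ _ _
    _ = ν.bind fun l' => μ.bind fun g => ν.bind fun l => PMF.pure (step o (-l') g⁻¹ (-l)) := by
        simp only [PMF.bind_comm μ ν]
    _ = (ν.map fun l => -l).bind fun l' => (μ.map fun g => g⁻¹).bind fun g =>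
          (ν.map fun l => -l).bind fun l => PMF.pure (step o l' g l) := by
        simp only [PMF.bind_map, Function.comp_def]
    _ = switchWalkSwitch o ν μ := by rw [hν, hμ]; rfl

theorem step_mem_support_switchWalkSwitch (o : S) {l l' : A} {g : Γ} (hl : l ∈ ν.support)
    (hg : g ∈ μ.support) (hl' : l' ∈ ν.support) :
    step o l g l' ∈ (switchWalkSwitch o ν μ).support := by
  simp only [switchWalkSwitch_eq_bind_step, PMF.mem_support_bind_iff, PMF.mem_support_pure_iff]
  exact ⟨l, hl, g, hg, l', hl', rfl⟩

theorem eq_top_of_inr_mem_of_switch_mem [MulAction.IsPretransitive Γ S]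
    {H : Subgroup (PermWreath A S Γ)} (hinr : ∀ g : Γ, SemidirectProduct.inr g ∈ H)
    (hswitch : ∀ l : A, switch o l ∈ H) : H = ⊤ := by
  have hinl (f : S →₀ A) : SemidirectProduct.inl (Multiplicative.ofAdd f) ∈ H := by
    induction f using Finsupp.induction_linear with
    | zero => rw [ofAdd_zero, map_one]; exact one_mem H
    | add f g hf hg => rw [ofAdd_add, map_mul]; exact mul_mem hf hg
    | single x l =>
      obtain ⟨g, rfl⟩ := MulAction.exists_smul_eq Γ o x
      rw [← switch, ← inr_mul_switch_mul_inr_inv]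
      exact mul_mem (mul_mem (hinr g) (hswitch l)) (inv_mem (hinr g))
  refine eq_top_iff.2 fun u _ => ?_
  rw [← SemidirectProduct.inl_left_mul_inr_right u]
  exact mul_mem (hinl (lamps u)) (hinr _)

theorem closure_support_switchWalkSwitch [MulAction.IsPretransitive Γ S]
    (hν : ν.support = Set.univ) (hμ : Subgroup.closure μ.support = ⊤) :
    Subgroup.closure (switchWalkSwitch o ν μ).support = ⊤ := by
  set H := Subgroup.closure (switchWalkSwitch o ν μ).support
  have hstep {l l' : A} {g : Γ} (hg : g ∈ μ.support) : step o l g l' ∈ H :=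
    Subgroup.subset_closure (step_mem_support_switchWalkSwitch o (by simp [hν]) hg (by simp [hν]))
  have hinr_support {g : Γ} (hg : g ∈ μ.support) : SemidirectProduct.inr g ∈ H := by
    simpa only [step, switch_zero, one_mul, mul_one] using hstep (l := 0) (l' := 0) hg
  have hinr (g : Γ) : SemidirectProduct.inr g ∈ H := by
    have hle : Subgroup.closure μ.support ≤ H.comap SemidirectProduct.inr :=
      (Subgroup.closure_le _).2 fun g hg => hinr_support hg
    exact hle (hμ ▸ Subgroup.mem_top g)
  obtain ⟨g, hg⟩ := μ.support_nonempty
  refine eq_top_of_inr_mem_of_switch_mem (o := o) hinr fun l => ?_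
  simpa only [step, switch_zero, mul_one, mul_inv_cancel_right] using
    mul_mem (hstep (l := l) (l' := 0) hg) (inv_mem (hinr g))

end SwitchWalkSwitch

section EscapePotential

open RandomWalk

/-- A bounded potential `φ ≥ 0` on `S` witnessing the transience of the walk `x ↦ g⁻¹ • x` with
`g` of law `μ`: it vanishes at `o`, is harmonic away from `o` and has positive drift at `o`. -/
structure IsEscapePotential (o : S) (μ : PMF Γ) (φ : S → ℝ) : Prop where
  nonneg : ∀ x, 0 ≤ φ x
  apply_base : φ o = 0
  harmonic : ∀ x, x ≠ o → mean μ (fun g => φ (g⁻¹ • x)) = φ x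
  drift_pos : 0 < mean μ fun g => φ (g⁻¹ • o)
  bounded : ∃ U, ∀ x, φ x ≤ U

variable {o : S} {μ : PMF Γ} {φ : S → ℝ}

/-- The lamp at the new position `o` does not contribute because `φ o = 0`, so only the switch at
the old position has to be averaged. -/
theorem lamp_mul_potential_mul_step (hφ : φ o = 0) (Φ : A → ℝ) (u : PermWreath A S Γ) (x : S)
    (l : A) (g : Γ) (l' : A) :
    Φ (lamps (u * step o l g l') x) * φ ((u * step o l g l').right⁻¹ • x) =
      Φ (lamps u x + Finsupp.single o l (u.right⁻¹ • x)) * φ (g⁻¹ • u.right⁻¹ • x) := by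
  rw [lamps_mul_step, mul_step_right, mul_inv_rev, mul_smul]
  by_cases h : g⁻¹ • u.right⁻¹ • x = o
  · rw [h, hφ, mul_zero, mul_zero]
  · rw [Finsupp.single_eq_of_ne h, add_zero]

theorem IsEscapePotential.exists_ne_zero (hφ : IsEscapePotential o μ φ) :
    ∃ g : Γ, φ (g⁻¹ • o) ≠ 0 := by
  by_contra! h
  exact hφ.drift_pos.ne' (by simp only [h, mean_const])

variable [Fintype A]

theorem mean_uniform_add_left (Φ : A → ℝ) (c : A) :
    mean (PMF.uniformOfFintype A) (fun l => Φ (c + l)) = mean (PMF.uniformOfFintype A) Φ := by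
  rw [mean_uniformOfFintype, mean_uniformOfFintype, ← Equiv.sum_comp (Equiv.addLeft c) Φ]
  rfl

variable [Finite μ.support]

open scoped Classical in
theorem IsEscapePotential.mean_lamp_mul_potential (hφ : IsEscapePotential o μ φ) (Φ : A → ℝ)
    (u : PermWreath A S Γ) (x : S) :
    mean (switchWalkSwitch o (PMF.uniformOfFintype A) μ)
        (fun s => Φ (lamps (u * s) x) * φ ((u * s).right⁻¹ • x)) =
      Φ (lamps u x) * φ (u.right⁻¹ • x) + if u.right⁻¹ • x = o then
        mean (PMF.uniformOfFintype A) Φ * mean μ (fun g => φ (g⁻¹ • o)) else 0 := by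
  simp only [mean_switchWalkSwitch, lamp_mul_potential_mul_step hφ.apply_base, mean_const,
    mean_const_mul, mean_mul_const]
  split_ifs with h
  · simp only [h, Finsupp.single_eq_same, mean_uniform_add_left, hφ.apply_base, mul_zero, zero_add]
  · simp only [Finsupp.single_eq_of_ne h, add_zero, mean_const, hφ.harmonic _ h]

theorem IsEscapePotential.isHarmonic_lamp_mul_potential (hφ : IsEscapePotential o μ φ)
    {Φ : A → ℝ} (hΦ : ∑ l, Φ l = 0) (x : S) :
    IsHarmonic (switchWalkSwitch o (PMF.uniformOfFintype A) μ)
      fun u => Φ (lamps u x) * φ (u.right⁻¹ • x) := by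
  refine isHarmonic_iff.2 fun u => ?_
  rw [hφ.mean_lamp_mul_potential, mean_uniformOfFintype, hΦ]
  simp

/-- The walk leaves `o` for good, after which the lamp at `o` no longer changes; `Φ` compares the
probabilities of two limiting values of that lamp. -/
theorem IsEscapePotential.not_liouville [Nontrivial A] (hφ : IsEscapePotential o μ φ) :
    ¬ Liouville (switchWalkSwitch o (PMF.uniformOfFintype A) μ) := by
  classical
  intro hL
  obtain ⟨c, hc⟩ := exists_ne (0 : A)
  obtain ⟨U, hU⟩ := hφ.bounded
  obtain ⟨g, hg⟩ := hφ.exists_ne_zero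
  let Φ : A → ℝ := Pi.single 0 1 - Pi.single c 1
  have hΦ0 : Φ 0 = 1 := by simp [Φ, hc.symm]
  have hΦc : Φ c = -1 := by simp [Φ, hc]
  have hbdd (u : PermWreath A S Γ) : |Φ (lamps u o) * φ (u.right⁻¹ • o)| ≤ (∑ l, |Φ l|) * U := by
    rw [abs_mul, abs_of_nonneg (hφ.nonneg _)]
    exact mul_le_mul (Finset.single_le_sum (fun l _ => abs_nonneg (Φ l)) (Finset.mem_univ _)) (hU _)
      (hφ.nonneg _) (Finset.sum_nonneg fun l _ => abs_nonneg (Φ l))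
  obtain ⟨d, hd⟩ := hL _ ⟨_, hbdd⟩
    (hφ.isHarmonic_lamp_mul_potential (Φ := Φ) (by simp [Φ, Finset.sum_sub_distrib]) o)
  have hoff : Φ 0 * φ (g⁻¹ • o) = d := by
    simpa [lamps] using hd (SemidirectProduct.inr g)
  have hon : Φ c * φ (g⁻¹ • o) = d := by
    have h := hd (switch o c * SemidirectProduct.inr g)
    rw [SemidirectProduct.mul_right, mul_left_apply] at h
    simpa [lamps, switch] using h
  rw [hΦ0] at hoff
  rw [hΦc] at hon
  exact hg (by linarith)

end EscapePotential

section Speed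

open RandomWalk

theorem card_support_lamps_mul_le (u v : PermWreath A S Γ) :
    (lamps (u * v)).support.card ≤ (lamps u).support.card + (lamps v).support.card := by
  classical
  rw [← Finset.card_image_of_injective (lamps v).support (MulAction.injective u.right)]
  refine le_trans (Finset.card_le_card fun x hx => ?_) (Finset.card_union_le _ _)
  rw [Finset.mem_union]
  by_contra! h
  rw [Finsupp.mem_support_iff, mul_left_apply, Finsupp.notMem_support_iff.1 h.1, zero_add,
    ← Finsupp.mem_support_iff] at hx
  exact h.2 (Finset.mem_image.2 ⟨_, hx, smul_inv_smul _ _⟩)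

theorem card_support_lamps_inv_le (u : PermWreath A S Γ) :
    (lamps u⁻¹).support.card ≤ (lamps u).support.card := by
  classical
  rw [← Finset.card_image_of_injective (lamps u).support (MulAction.injective u.right⁻¹)]
  refine Finset.card_le_card fun x hx => Finset.mem_image.2 ⟨u.right • x, ?_, inv_smul_smul _ _⟩
  have h := mul_left_apply u u⁻¹ (u.right • x)
  rw [mul_inv_cancel, inv_smul_smul] at h
  rw [Finsupp.mem_support_iff] at hx ⊢
  intro h0
  rw [h0, zero_add] at h
  exact hx h.symm

theorem exists_card_support_lamps_le_wordLength {T : Set (PermWreath A S Γ)} (hT : T.Finite)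
    (hcl : Subgroup.closure T = ⊤) :
    ∃ C : ℕ, ∀ u, (lamps u).support.card ≤ C * wordLength T u := by
  obtain ⟨C, hC⟩ := (hT.image fun t => (lamps t).support.card).bddAbove
  exact ⟨C, le_mul_wordLength hcl (by simp) card_support_lamps_mul_le card_support_lamps_inv_le
    fun t ht => hC ⟨t, ht, rfl⟩⟩

/-- The total potential of the lamps that are on, as seen from the current position. -/
noncomputable def lampPotential (φ : S → ℝ) (u : PermWreath A S Γ) : ℝ :=
  ∑ x ∈ (lamps u).support, φ (u.right⁻¹ • x)

variable {o : S} {μ : PMF Γ} {φ : S → ℝ}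

open scoped Classical in
theorem lampPotential_eq_sum (φ : S → ℝ) (u : PermWreath A S Γ) {E : Finset S}
    (hE : (lamps u).support ⊆ E) :
    lampPotential φ u = ∑ x ∈ E, (if lamps u x = 0 then 0 else 1) * φ (u.right⁻¹ • x) := by
  refine (Finset.sum_congr rfl fun x hx => ?_).trans (Finset.sum_subset hE fun x _ hx => ?_)
  · rw [if_neg (Finsupp.mem_support_iff.1 hx), one_mul]
  · rw [if_pos (Finsupp.notMem_support_iff.1 hx), zero_mul]

open scoped Classical in
theorem sum_le_lampPotential (hφ : ∀ x, 0 ≤ φ x) (u : PermWreath A S Γ) (E : Finset S) :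
    ∑ x ∈ E, (if lamps u x = 0 then 0 else 1) * φ (u.right⁻¹ • x) ≤ lampPotential φ u := by
  rw [lampPotential_eq_sum φ u (Finset.subset_union_right (s₁ := E))]
  refine Finset.sum_le_sum_of_subset_of_nonneg Finset.subset_union_left fun x _ _ => ?_
  exact mul_nonneg (by split_ifs <;> norm_num) (hφ _)

open scoped Classical in
/-- Away from the lamp at the current position the potential of the lamps is a martingale; that
lamp is refreshed and contributes the drift. -/
theorem IsEscapePotential.lampPotential_add_le_mean [Fintype A] [Finite μ.support]
    (hφ : IsEscapePotential o μ φ) (u : PermWreath A S Γ) :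
    lampPotential φ u + mean (PMF.uniformOfFintype A) (fun l => if l = 0 then 0 else 1) *
        mean μ (fun g => φ (g⁻¹ • o)) ≤
      mean (switchWalkSwitch o (PMF.uniformOfFintype A) μ) fun s => lampPotential φ (u * s) := by
  let E : Finset S := insert (u.right • o) (lamps u).support
  refine le_trans (le_of_eq ?_) (mean_mono fun s => sum_le_lampPotential hφ.nonneg (u * s) E)
  rw [mean_finset_sum, Finset.sum_congr rfl fun x _ =>
    hφ.mean_lamp_mul_potential (fun l => if l = 0 then 0 else 1) u x, Finset.sum_add_distrib,
    ← lampPotential_eq_sum φ u (Finset.subset_insert _ _)]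
  simp only [inv_smul_eq_iff, Finset.sum_ite_eq', E, Finset.mem_insert_self, if_true]

theorem lampPotential_le {U : ℝ} (hU : ∀ x, φ x ≤ U) (u : PermWreath A S Γ) :
    lampPotential φ u ≤ U * (lamps u).support.card :=
  (Finset.sum_le_card_nsmul _ _ U fun x _ => hU _).trans_eq (by rw [nsmul_eq_mul, mul_comm])

open scoped Classical in
theorem mean_uniform_ne_zero_pos [Fintype A] [Nontrivial A] :
    0 < mean (PMF.uniformOfFintype A) fun l => if l = 0 then 0 else 1 := by
  obtain ⟨c, hc⟩ := exists_ne (0 : A)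
  rw [mean_uniformOfFintype]
  refine div_pos (Finset.sum_pos' (fun l _ => ?_) ⟨c, Finset.mem_univ c, ?_⟩) (by positivity)
  · split_ifs <;> norm_num
  · simp [hc]

theorem IsEscapePotential.positiveSpeed [Fintype A] [Nontrivial A] [Finite μ.support]
    (hφ : IsEscapePotential o μ φ) :
    PositiveSpeed (switchWalkSwitch o (PMF.uniformOfFintype A) μ) := by
  classical
  intro T hT hcl
  obtain ⟨C, hC⟩ := exists_card_support_lamps_le_wordLength hT hcl
  obtain ⟨U, hU⟩ := hφ.bounded
  have hU0 : 0 ≤ U := hφ.apply_base ▸ hU o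
  set δ := mean (PMF.uniformOfFintype A) (fun l => if l = 0 then 0 else 1) *
    mean μ (fun g => φ (g⁻¹ • o))
  have hδ0 : 0 < δ := mul_pos mean_uniform_ne_zero_pos hφ.drift_pos
  have hle (u : PermWreath A S Γ) : lampPotential φ u ≤ (U * C + 1) * wordLength T u := by
    have hCu : ((lamps u).support.card : ℝ) ≤ C * wordLength T u := by exact_mod_cast hC u
    nlinarith [lampPotential_le hU u, mul_le_mul_of_nonneg_left hCu hU0,
      Nat.cast_nonneg (α := ℝ) (wordLength T u)]
  refine ⟨δ / (U * C + 1), by positivity, fun n => ?_⟩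
  change _ ≤ mean _ _
  rw [div_mul_eq_mul_div, div_le_iff₀' (by positivity), ← mean_const_mul]
  calc δ * n = lampPotential φ (1 : PermWreath A S Γ) + n * δ := by
        simp [lampPotential, lamps, mul_comm]
    _ ≤ _ := le_mean_law_of_drift hφ.lampPotential_add_le_mean n
    _ ≤ _ := mean_mono hle

end Speed

end PermWreath

/-! ### The bubble graph and its potential -/

namespace Bubble

section Generators

open RandomWalk

variable {α : ℕ → ℕ} (hα : ∀ k, 1 ≤ k → 1 ≤ α k)

theorem genA_smul (w : List Bool) (i : ZMod (2 * α (w.length + 1))) :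
    genA hα • (⟨w, i⟩ : Vertex α) = ⟨w, i + 1⟩ := rfl

theorem genA_inv_smul (w : List Bool) (i : ZMod (2 * α (w.length + 1))) :
    (genA hα)⁻¹ • (⟨w, i⟩ : Vertex α) = ⟨w, i - 1⟩ := by
  rw [inv_smul_eq_iff, genA_smul, sub_add_cancel]

theorem genB_smul (x : Vertex α) : genB hα • x = bFun α x := rfl

theorem genB_inv_smul (x : Vertex α) : (genB hα)⁻¹ • x = bInvFun α x := rfl

theorem genA_pow_smul_start (w : List Bool) (n : ℕ) :
    genA hα ^ n • start α w = ⟨w, (n : ZMod _)⟩ := by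
  induction n with
  | zero => simp [start]
  | succ n ih => rw [pow_succ', mul_smul, ih, genA_smul, Nat.cast_succ]

theorem exists_smul_root_eq_start (w : List Bool) :
    ∃ g : BubbleGroup hα, g • root α = start α w := by
  induction w with
  | nil => exact ⟨1, one_smul _ _⟩
  | cons c w ih =>
    obtain ⟨g, hg⟩ := ih
    have hfalse : (genB hα * (genA hα ^ α (w.length + 1) * g)) • root α = start α (false :: w) := by
      rw [mul_smul, mul_smul, hg, genA_pow_smul_start, ← middle, genB_smul, bFun_middle]
    cases c with
    | false => exact ⟨_, hfalse⟩
    | true =>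
      refine ⟨genB hα * (genB hα * (genA hα ^ α (w.length + 1) * g)), ?_⟩
      rw [mul_smul, hfalse, genB_smul, bFun_start_false hα]

instance isPretransitive_bubbleGroup : MulAction.IsPretransitive (BubbleGroup hα) (Vertex α) := by
  refine (MulAction.isPretransitive_iff_base (root α)).2 fun ⟨w, i⟩ => ?_
  obtain ⟨g, hg⟩ := exists_smul_root_eq_start hα w
  have : NeZero (2 * α (w.length + 1)) := ⟨by have := hα (w.length + 1) (by omega); omega⟩
  refine ⟨genA hα ^ i.val * g, ?_⟩
  rw [mul_smul, hg, genA_pow_smul_start, ZMod.natCast_zmod_val]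

instance finite_support_simpleStep : Finite (simpleStep hα).support := by
  unfold simpleStep
  infer_instance

theorem mean_simpleStep (F : BubbleGroup hα → ℝ) :
    mean (simpleStep hα) F =
      (F (genA hα) + F (genA hα)⁻¹ + (F (genB hα) + F (genB hα)⁻¹)) / 4 := by
  rw [simpleStep, mean_map, mean_uniformOfFintype, Fin.sum_univ_four]
  simp [add_assoc]

theorem map_inv_simpleStep : (simpleStep hα).map (fun g => g⁻¹) = simpleStep hα := by
  let σ : Equiv.Perm (Fin 4) := Equiv.swap 0 1 * Equiv.swap 2 3
  rw [simpleStep, PMF.map_comp]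
  conv_rhs => rw [← map_equiv_uniformOfFintype σ, PMF.map_comp]
  congr 1
  funext i
  fin_cases i <;> simp [σ, Equiv.swap_apply_def]

theorem closure_support_simpleStep : Subgroup.closure (simpleStep hα).support = ⊤ := by
  refine top_unique ((Subgroup.closure_closure_coe_preimage (k := {a α, b hα})).ge.trans
    (Subgroup.closure_mono ?_))
  rintro ⟨g, hg⟩ (rfl | rfl)
  · simp only [simpleStep, PMF.mem_support_map_iff]
    exact ⟨0, by simp, rfl⟩
  · simp only [simpleStep, PMF.mem_support_map_iff]
    exact ⟨2, by simp, rfl⟩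

end Generators

section Potential

open RandomWalk

/-- The distance from `0` on the cycle `ℤ / 2A`. -/
def cycleDist (A : ℕ) (i : ZMod (2 * A)) : ℕ := min i.val (2 * A - i.val)

theorem cycleDist_le (A : ℕ) (i : ZMod (2 * A)) : cycleDist A i ≤ A := by
  unfold cycleDist
  omega

theorem cycleDist_natCast {A n : ℕ} (hn : n ≤ 2 * A) :
    cycleDist A (n : ZMod (2 * A)) = min n (2 * A - n) := by
  unfold cycleDist
  rw [ZMod.val_natCast]
  rcases hn.lt_or_eq with h | rfl
  · rw [Nat.mod_eq_of_lt h]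
  · simp

theorem cycleDist_zero (A : ℕ) : cycleDist A 0 = 0 := by
  simpa using cycleDist_natCast (A := A) (n := 0) (by omega)

theorem cycleDist_middle (A : ℕ) : cycleDist A (A : ZMod (2 * A)) = A := by
  rw [cycleDist_natCast (by omega)]
  omega

theorem cycleDist_one {A : ℕ} (hA : 1 ≤ A) : cycleDist A 1 = 1 := by
  rw [← Nat.cast_one, cycleDist_natCast (by omega)]
  omega

theorem cycleDist_neg_one {A : ℕ} (hA : 1 ≤ A) : cycleDist A (-1) = 1 := by
  have h : (-1 : ZMod (2 * A)) = (2 * A - 1 : ℕ) := by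
    rw [Nat.cast_sub (by omega), ZMod.natCast_self, Nat.cast_one, zero_sub]
  rw [h, cycleDist_natCast (by omega)]
  omega

theorem cycleDist_middle_add_one {A : ℕ} (hA : 1 ≤ A) :
    cycleDist A ((A : ZMod (2 * A)) + 1) = A - 1 := by
  rw [← Nat.cast_succ, cycleDist_natCast (by omega)]
  omega

theorem cycleDist_middle_sub_one {A : ℕ} (hA : 1 ≤ A) :
    cycleDist A ((A : ZMod (2 * A)) - 1) = A - 1 := by
  rw [← Nat.cast_pred hA, cycleDist_natCast (by omega)]
  omega

theorem cycleDist_add_one_add_cycleDist_sub_one {A : ℕ} (hA : 1 ≤ A) (i : ZMod (2 * A))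
    (h0 : i ≠ 0) (hmid : i ≠ (A : ZMod (2 * A))) :
    cycleDist A (i + 1) + cycleDist A (i - 1) = 2 * cycleDist A i := by
  have : NeZero (2 * A) := ⟨by omega⟩
  obtain ⟨n, hn, rfl⟩ : ∃ n : ℕ, n < 2 * A ∧ (n : ZMod (2 * A)) = i :=
    ⟨i.val, i.val_lt, ZMod.natCast_zmod_val i⟩
  have hn0 : 0 < n := Nat.pos_of_ne_zero fun h => h0 (by simp [h])
  have hnA : n ≠ A := fun h => hmid (by rw [h])
  rw [← Nat.cast_succ, ← Nat.cast_pred hn0, cycleDist_natCast (by omega),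
    cycleDist_natCast (by omega), cycleDist_natCast hn.le]
  omega

/-- The potential of the unit flow from the root to infinity, normalised to vanish at the root.
The flow splits evenly at every branching cycle, hence is `2 ^ (-k)` on the edges of level `k`. -/
noncomputable def potential (α : ℕ → ℕ) (x : Vertex α) : ℝ :=
  ∑ j ∈ Finset.range x.1.length, ((α (j + 1) : ℝ) + 1) / 2 ^ (j + 1) +
    (cycleDist (α (x.1.length + 1)) x.2 : ℝ) / 2 ^ (x.1.length + 1)

variable {α : ℕ → ℕ}

theorem potential_nonneg (x : Vertex α) : 0 ≤ potential α x := by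
  unfold potential
  positivity

theorem potential_start (w : List Bool) :
    potential α (start α w) =
      ∑ j ∈ Finset.range w.length, ((α (j + 1) : ℝ) + 1) / 2 ^ (j + 1) := by
  simp [potential, start, cycleDist_zero]

theorem potential_start_cons (c : Bool) (w : List Bool) :
    potential α (start α (c :: w)) =
      potential α (middle α w) + 1 / 2 ^ (w.length + 1) := by
  rw [potential_start, List.length_cons, Finset.sum_range_succ, potential, middle,
    cycleDist_middle]
  ring

theorem potential_root : potential α (root α) = 0 :=
  (potential_start []).trans (by simp)

theorem potential_le_tsum (hsum : Summable fun k => (α (k + 1) : ℝ) / 2 ^ (k + 1))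
    (x : Vertex α) : potential α x ≤ ∑' j, ((α (j + 1) : ℝ) + 1) / 2 ^ (j + 1) := by
  have hgeom : Summable fun k : ℕ => (1 : ℝ) / 2 ^ (k + 1) :=
    ((summable_nat_add_iff 1).2 summable_geometric_two).congr fun k => by rw [one_div_pow]
  have hsum' : Summable fun j => ((α (j + 1) : ℝ) + 1) / 2 ^ (j + 1) := by
    simpa only [add_div] using hsum.add hgeom
  refine le_trans ?_ (hsum'.sum_le_tsum (Finset.range (x.1.length + 1)) fun j _ => by positivity)
  rw [Finset.sum_range_succ, potential]
  gcongr
  exact_mod_cast (cycleDist_le _ _).trans (Nat.le_succ _)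

variable (hα : ∀ k, 1 ≤ k → 1 ≤ α k)

theorem potential_genA_smul_start (w : List Bool) :
    potential α (genA hα • start α w) + potential α ((genA hα)⁻¹ • start α w) =
      2 * potential α (start α w) + 2 / 2 ^ (w.length + 1) := by
  have hA := hα (w.length + 1) (by omega)
  rw [start, genA_smul, genA_inv_smul, zero_add, zero_sub]
  simp only [potential, cycleDist_zero, cycleDist_one hA, cycleDist_neg_one hA]
  push_cast
  ring

theorem potential_genA_smul_middle (w : List Bool) :
    potential α (genA hα • middle α w) + potential α ((genA hα)⁻¹ • middle α w) =
      2 * potential α (middle α w) - 2 / 2 ^ (w.length + 1) := by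
  have hA := hα (w.length + 1) (by omega)
  rw [middle, genA_smul, genA_inv_smul]
  simp only [potential, cycleDist_middle, cycleDist_middle_add_one hA,
    cycleDist_middle_sub_one hA]
  push_cast [Nat.cast_sub hA]
  ring

theorem mean_simpleStep_inv_smul (F : Vertex α → ℝ) (x : Vertex α) :
    mean (simpleStep hα) (fun g => F (g⁻¹ • x)) =
      (F (genA hα • x) + F ((genA hα)⁻¹ • x) + (F (bFun α x) + F (bInvFun α x))) / 4 := by
  rw [mean_simpleStep, inv_inv, inv_inv, genB_smul, genB_inv_smul]
  ring

theorem mean_potential_root :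
    mean (simpleStep hα) (fun g => potential α (g⁻¹ • root α)) = 1 / 4 := by
  rw [mean_simpleStep_inv_smul, bFun_root hα, bInvFun_root hα, potential_root,
    show root α = start α [] from rfl, potential_genA_smul_start, potential_start]
  norm_num

theorem mean_potential (x : Vertex α) (hx : x ≠ root α) :
    mean (simpleStep hα) (fun g => potential α (g⁻¹ • x)) = potential α x := by
  rw [mean_simpleStep_inv_smul, div_eq_iff (by norm_num)]
  induction x using vertex_cases with
  | h_root => exact absurd rfl hx
  | h_middle w =>
    rw [potential_genA_smul_middle, bFun_middle, bInvFun_middle, potential_start_cons,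
      potential_start_cons]
    ring
  | h_false w =>
    rw [potential_genA_smul_start, bFun_start_false hα, bInvFun_start_false hα,
      potential_start_cons, potential_start_cons, List.length_cons]
    ring
  | h_true w =>
    rw [potential_genA_smul_start, bFun_start_true hα, bInvFun_start_true hα,
      potential_start_cons, potential_start_cons, List.length_cons]
    ring
  | h_other w i hmid h0 =>
    have hlinear : (cycleDist (α (w.length + 1)) (i + 1) : ℝ) +
        cycleDist (α (w.length + 1)) (i - 1) = 2 * cycleDist (α (w.length + 1)) i := by
      exact_mod_cast
        cycleDist_add_one_add_cycleDist_sub_one (hα (w.length + 1) (by omega)) i h0 hmid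
    rw [bFun_other w i hmid h0, bInvFun_other w i hmid h0, genA_smul, genA_inv_smul]
    simp only [potential]
    linear_combination hlinear / 2 ^ (w.length + 1)

theorem isEscapePotential_potential (hsum : Summable fun k => (α (k + 1) : ℝ) / 2 ^ (k + 1)) :
    PermWreath.IsEscapePotential (root α) (simpleStep hα) (potential α) where
  nonneg := potential_nonneg
  apply_base := potential_root
  harmonic := mean_potential hα
  drift_pos := by rw [mean_potential_root]; norm_num
  bounded := ⟨_, potential_le_tsum hsum⟩

end Potential

end Bubble

/-! ### Words with a confined exponent sum -/

namespace Bubble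

open RandomWalk PermWreath

section Letters

variable {α : ℕ → ℕ} (hα : ∀ k, 1 ≤ k → 1 ≤ α k)

/-- The letters `a`, `a⁻¹`, `b`, `b⁻¹`, numbered as in `simpleStep`. -/
noncomputable def letter : Fin 4 → BubbleGroup hα :=
  ![genA hα, (genA hα)⁻¹, genB hα, (genB hα)⁻¹]

/-- The exponent of `a` in a letter. -/
def exponent : Fin 4 → ℤ := ![1, -1, 0, 0]

theorem abs_exponent_le_one (s : Fin 4) : |exponent s| ≤ 1 := by
  fin_cases s <;> simp [exponent]

theorem mean_simpleStep_eq_mean_letter (F : BubbleGroup hα → ℝ) :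
    mean (simpleStep hα) F = mean (PMF.uniformOfFintype (Fin 4)) fun s => F (letter hα s) :=
  mean_map _ _

theorem letter_smul_of_ne (s : Fin 4) (w : List Bool) {i : ZMod (2 * α (w.length + 1))}
    (hmiddle : i ≠ (α (w.length + 1) : ZMod _)) (hstart : i ≠ 0) :
    letter hα s • (⟨w, i⟩ : Vertex α) = ⟨w, i + (exponent s : ZMod _)⟩ := by
  fin_cases s
  · simp [letter, exponent, genA_smul]
  · simp [letter, exponent, genA_inv_smul, sub_eq_add_neg]
  · simpa [letter, exponent, genB_smul] using bFun_other w i hmiddle hstart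
  · simpa [letter, exponent, genB_inv_smul] using bInvFun_other w i hmiddle hstart

theorem intCast_ne_middle {N : ℕ} {i : ℤ} (hi : |i| < N) :
    (i : ZMod (2 * N)) ≠ (N : ZMod (2 * N)) := by
  intro h
  rw [← Int.cast_natCast, ZMod.intCast_eq_intCast_iff_dvd_sub] at h
  rw [abs_lt] at hi
  have := Int.le_of_dvd (by omega) h
  omega

theorem eq_zero_of_intCast_eq_zero {N : ℕ} {i : ℤ} (hi : |i| < N)
    (h : (i : ZMod (2 * N)) = 0) : i = 0 := by
  rw [ZMod.intCast_zmod_eq_zero_iff_dvd] at h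
  exact Int.eq_zero_of_abs_lt_dvd h (by omega)

end Letters

section Tripod

variable {α : ℕ → ℕ} (hα : ∀ k, 1 ≤ k → 1 ≤ α k)

/-- The action of a letter on the tripod: three disjoint lines along which `a` shifts and whose
origins are permuted cyclically by `b`. It is the limit of the bubble graph around a branching
cycle as the neighbouring cycles become long. -/
def tripodStep (s : Fin 4) (t : Fin 3 × ℤ) : Fin 3 × ℤ :=
  (if t.2 = 0 then t.1 + ![0, 0, 1, 2] s else t.1, t.2 + exponent s)

/-- The map from the tripod to the bubble graph that sends the three origins to the branching
cycle through the middle point of `v`. -/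
def tripodEmbed (α : ℕ → ℕ) (v : List Bool) (t : Fin 3 × ℤ) : Vertex α :=
  match t.1 with
  | 0 => ⟨v, (α (v.length + 1) : ZMod _) + (t.2 : ZMod _)⟩
  | 1 => ⟨false :: v, (t.2 : ZMod _)⟩
  | 2 => ⟨true :: v, (t.2 : ZMod _)⟩

theorem genA_smul_tripodEmbed (v : List Bool) (j : Fin 3) (i : ℤ) :
    genA hα • tripodEmbed α v (j, i) = tripodEmbed α v (j, i + 1) := by
  fin_cases j <;> simp [tripodEmbed, genA_smul, add_assoc]

theorem genB_smul_tripodEmbed_zero (v : List Bool) (j : Fin 3) :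
    genB hα • tripodEmbed α v (j, 0) = tripodEmbed α v (j + 1, 0) := by
  have hmiddle : tripodEmbed α v (0, 0) = middle α v := by simp [tripodEmbed, middle]
  have hfalse : tripodEmbed α v (1, 0) = start α (false :: v) := by simp [tripodEmbed, start]
  have htrue : tripodEmbed α v (2, 0) = start α (true :: v) := by simp [tripodEmbed, start]
  rw [genB_smul]
  fin_cases j
  · exact (congrArg _ hmiddle).trans ((bFun_middle v).trans hfalse.symm)
  · exact (congrArg _ hfalse).trans ((bFun_start_false hα v).trans htrue.symm)
  · exact (congrArg _ htrue).trans ((bFun_start_true hα v).trans hmiddle.symm)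

theorem genB_smul_tripodEmbed_of_ne_zero (v : List Bool) (j : Fin 3) {i : ℤ} (hi : i ≠ 0)
    (hv : |i| < α (v.length + 1)) (hv' : |i| < α (v.length + 2)) :
    genB hα • tripodEmbed α v (j, i) = tripodEmbed α v (j, i) := by
  have hchild (c : Bool) : bFun α ⟨c :: v, (i : ZMod _)⟩ = ⟨c :: v, (i : ZMod _)⟩ :=
    bFun_other (c :: v) _ (intCast_ne_middle hv') fun h => hi (eq_zero_of_intCast_eq_zero hv' h)
  rw [genB_smul]
  fin_cases j
  · refine bFun_other v _ (fun h => hi (eq_zero_of_intCast_eq_zero hv (by simpa using h)))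
      fun h => intCast_ne_middle (N := α (v.length + 1)) (i := -i) (by rwa [abs_neg]) ?_
    rw [Int.cast_neg]
    exact (eq_neg_of_add_eq_zero_left h).symm
  · exact hchild false
  · exact hchild true

theorem genB_smul_tripodEmbed (v : List Bool) (t : Fin 3 × ℤ) (hv : |t.2| < α (v.length + 1))
    (hv' : |t.2| < α (v.length + 2)) :
    genB hα • tripodEmbed α v t = tripodEmbed α v (tripodStep 2 t) := by
  obtain ⟨j, i⟩ := t
  by_cases hi : i = 0
  · subst hi
    simpa [tripodStep, exponent] using genB_smul_tripodEmbed_zero hα v j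
  · simpa [tripodStep, exponent, hi] using genB_smul_tripodEmbed_of_ne_zero hα v j hi hv hv'

theorem tripodStep_two_three (t : Fin 3 × ℤ) : tripodStep 2 (tripodStep 3 t) = t := by
  obtain ⟨j, i⟩ := t
  by_cases hi : i = 0 <;> simp [tripodStep, exponent, hi, add_assoc]

theorem letter_smul_tripodEmbed (s : Fin 4) (v : List Bool) (t : Fin 3 × ℤ)
    (hv : |t.2| < α (v.length + 1)) (hv' : |t.2| < α (v.length + 2)) :
    letter hα s • tripodEmbed α v t = tripodEmbed α v (tripodStep s t) := by
  fin_cases s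
  · simpa [letter, tripodStep, exponent] using genA_smul_tripodEmbed hα v t.1 t.2
  · change (genA hα)⁻¹ • _ = _
    rw [inv_smul_eq_iff]
    simpa [tripodStep, exponent] using (genA_smul_tripodEmbed hα v t.1 (t.2 + -1)).symm
  · exact genB_smul_tripodEmbed hα v t hv hv'
  · have hsnd : (tripodStep 3 t).2 = t.2 := by simp [tripodStep, exponent]
    change (genB hα)⁻¹ • _ = tripodEmbed α v (tripodStep 3 t)
    rw [inv_smul_eq_iff, genB_smul_tripodEmbed hα v _ (by rwa [hsnd]) (by rwa [hsnd]),
      tripodStep_two_three]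

end Tripod

section Confined

variable {A : Type*} [AddCommGroup A] {α : ℕ → ℕ} (hα : ∀ k, 1 ≤ k → 1 ≤ α k)

/-- `Confined hα m x g τ` says that `g` is a product of increments of the switch-walk-switch walk
such that the exponent sums of `a` in all prefixes of the underlying word have absolute value at
most `m`. Here `x` is the exponent sum of the whole word and `τ` is its action on the tripod. -/
inductive Confined (m : ℕ) : ℤ → PermWreath A (Vertex α) (BubbleGroup hα) →
    (Fin 3 × ℤ → Fin 3 × ℤ) → Prop
  | one : Confined m 0 1 id
  | mul_step {x g τ} (h : Confined m x g τ) (l : A) (s : Fin 4) (l' : A)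
      (hx : |x + exponent s| ≤ m) :
      Confined m (x + exponent s) (g * step (root α) l (letter hα s) l') (τ ∘ tripodStep s)

/-- The elements represented by a confined word. -/
def confinedSet (A : Type*) [AddCommGroup A] (m : ℕ) :
    Set (PermWreath A (Vertex α) (BubbleGroup hα)) :=
  {g | ∃ x τ, Confined hα m x g τ}

variable {hα} {m L : ℕ} {x : ℤ} {g : PermWreath A (Vertex α) (BubbleGroup hα)}
  {τ : Fin 3 × ℤ → Fin 3 × ℤ}

theorem Confined.abs_le (h : Confined hα m x g τ) : |x| ≤ m := by
  cases h with
  | one => simp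
  | mul_step _ _ _ _ hx => exact hx

theorem Confined.tripod_snd (h : Confined hα m x g τ) (t : Fin 3 × ℤ) : (τ t).2 = t.2 + x := by
  induction h generalizing t with
  | one => simp
  | mul_step _ _ s _ _ ih =>
    rw [Function.comp_apply, ih, tripodStep]
    ring

theorem Confined.smul_tripodEmbed (h : Confined hα m x g τ) {v : List Bool}
    (hv : 4 * m + 1 ≤ α (v.length + 1)) (hv' : 4 * m + 1 ≤ α (v.length + 2)) {t : Fin 3 × ℤ}
    (ht : |t.2 + x| ≤ 3 * m) : g.right • tripodEmbed α v t = tripodEmbed α v (τ t) := by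
  induction h generalizing t with
  | one => simp
  | @mul_step x g τ _ _ s _ hx ih =>
    have ht' : |t.2| ≤ 4 * m := by
      rw [_root_.abs_le] at ht hx ⊢
      constructor <;> linarith
    rw [mul_step_right, mul_smul, letter_smul_tripodEmbed hα s v t (by omega) (by omega),
      Function.comp_apply]
    refine ih ?_
    rwa [tripodStep, add_assoc, add_comm (exponent s) x]

theorem Confined.smul_of_far (h : Confined hα m x g τ) (w : List Bool)
    (i : ZMod (2 * α (w.length + 1)))
    (hstart : ∀ z : ℤ, |z| ≤ m → i + ((x + z : ℤ) : ZMod _) ≠ 0)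
    (hmiddle : ∀ z : ℤ, |z| ≤ m → i + ((x + z : ℤ) : ZMod _) ≠ (α (w.length + 1) : ZMod _)) :
    g.right • (⟨w, i⟩ : Vertex α) = ⟨w, i + (x : ZMod _)⟩ := by
  induction h generalizing i with
  | one => simp
  | @mul_step x g _ _ _ s _ hx ih =>
    have hshift (z : ℤ) : i + (exponent s : ZMod (2 * α (w.length + 1))) + ((x + z : ℤ) : ZMod _) =
        i + ((x + exponent s + z : ℤ) : ZMod (2 * α (w.length + 1))) := by
      push_cast
      ring
    have hletter : letter hα s • (⟨w, i⟩ : Vertex α) = ⟨w, i + exponent s⟩ := by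
      have hz : |(-(x + exponent s))| ≤ m := by rwa [abs_neg]
      exact letter_smul_of_ne hα s w (by simpa using hmiddle _ hz) (by simpa using hstart _ hz)
    rw [mul_step_right, mul_smul, hletter, ih _ (fun z hz => hshift z ▸ hstart z hz)
      fun z hz => hshift z ▸ hmiddle z hz]
    simpa using hshift 0

/-- The vertices that a confined word with exponent sum `x` cannot move beyond the cycles indexed
by words of length `L`: those on earlier cycles, and those on a cycle indexed by a word of length
`L` which the shift by `x` brings to distance at most `3 * m` from the starting point. -/
def Shallow (L m : ℕ) (x : ℤ) (y : Vertex α) : Prop :=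
  y.1.length < L ∨ (y.1.length = L ∧ ∃ c : ℤ, |c| ≤ 3 * m ∧ y.2 = ((c - x : ℤ) : ZMod _))

theorem Shallow.length_le {y : Vertex α} (h : Shallow L m x y) : y.1.length ≤ L := by
  rcases h with h | h
  · exact h.le
  · exact h.1.le

theorem shallow_start {w : List Bool} (hx : |x| ≤ m) (hw : w.length ≤ L) :
    Shallow L m x (start α w) := by
  rcases hw.lt_or_eq with h | h
  · exact Or.inl h
  · exact Or.inr ⟨h, x, by omega, by rw [sub_self, Int.cast_zero]; rfl⟩

theorem Shallow.length_lt_of_middle {w : List Bool} (hL : 4 * m + 1 ≤ α (L + 1))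
    (hx : |x| ≤ m) (h : Shallow L m x (middle α w)) : w.length < L := by
  rcases h with h | ⟨rfl, c, hc, hi⟩
  · exact h
  · refine absurd hi.symm (intCast_ne_middle (N := α (w.length + 1)) ?_)
    have := abs_sub c x
    change 4 * m + 1 ≤ α (w.length + 1) at hL
    omega

theorem Shallow.genA_smul {y : Vertex α} (h : Shallow L m (x + 1) y) :
    Shallow L m x (genA hα • y) := by
  refine h.imp_right fun ⟨hy, c, hc, hi⟩ => ⟨hy, c, hc, ?_⟩
  change y.2 + 1 = ((c - x : ℤ) : ZMod (2 * α (y.1.length + 1)))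
  rw [hi]
  push_cast
  ring

theorem Shallow.genA_inv_smul {y : Vertex α} (h : Shallow L m (x + -1) y) :
    Shallow L m x ((genA hα)⁻¹ • y) := by
  obtain ⟨w, i⟩ := y
  rw [Bubble.genA_inv_smul]
  refine h.imp_right fun ⟨hy, c, hc, hi⟩ => ⟨hy, c, hc, ?_⟩
  change i - 1 = ((c - x : ℤ) : ZMod (2 * α (w.length + 1)))
  rw [show i = _ from hi]
  push_cast
  ring

theorem Shallow.bFun_bInvFun (hα : ∀ k, 1 ≤ k → 1 ≤ α k) {y : Vertex α}
    (hL : 4 * m + 1 ≤ α (L + 1)) (hx : |x| ≤ m)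
    (h : Shallow L m x y) : Shallow L m x (bFun α y) ∧ Shallow L m x (bInvFun α y) := by
  induction y using vertex_cases with
  | h_root => rw [bFun_root hα, bInvFun_root hα]; exact ⟨h, h⟩
  | h_middle w =>
    have hw := h.length_lt_of_middle hL hx
    rw [bFun_middle, bInvFun_middle]
    exact ⟨shallow_start hx hw, shallow_start hx hw⟩
  | h_false w =>
    have hw := h.length_le
    rw [bFun_start_false hα, bInvFun_start_false hα]
    exact ⟨shallow_start hx hw, Or.inl hw⟩
  | h_true w =>
    have hw := h.length_le
    rw [bFun_start_true hα, bInvFun_start_true hα]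
    exact ⟨Or.inl hw, shallow_start hx hw⟩
  | h_other w i hmiddle hstart =>
    rw [bFun_other w i hmiddle hstart, bInvFun_other w i hmiddle hstart]
    exact ⟨h, h⟩

theorem Shallow.letter_smul {y : Vertex α} {s : Fin 4} (hL : 4 * m + 1 ≤ α (L + 1))
    (hx : |x| ≤ m) (h : Shallow L m (x + exponent s) y) :
    Shallow L m x (letter hα s • y) := by
  fin_cases s
  · exact h.genA_smul
  · exact h.genA_inv_smul
  · exact (Shallow.bFun_bInvFun hα hL hx (by simpa [exponent] using h)).1
  · exact (Shallow.bFun_bInvFun hα hL hx (by simpa [exponent] using h)).2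

theorem Confined.length_smul_le (h : Confined hα m x g τ) (hL : 4 * m + 1 ≤ α (L + 1))
    {y : Vertex α} (hy : Shallow L m x y) : (g.right • y).1.length ≤ L := by
  induction h generalizing y with
  | one => simpa using hy.length_le
  | mul_step h _ _ _ _ ih =>
    rw [mul_step_right, mul_smul]
    exact ih (hy.letter_smul hL h.abs_le)

theorem Confined.inv_smul_ne_root (h : Confined hα m x g τ) (hL₀ : 0 < L)
    (hL : 4 * m + 1 ≤ α (L + 1)) {y : Vertex α} (hy : L < y.1.length) :
    g.right⁻¹ • y ≠ root α := by
  intro hroot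
  rw [inv_smul_eq_iff] at hroot
  have := h.length_smul_le hL (y := root α) (Or.inl hL₀)
  rw [← hroot] at this
  omega

theorem Confined.lamps_eq_zero (h : Confined hα m x g τ) (hL₀ : 0 < L)
    (hL : 4 * m + 1 ≤ α (L + 1)) {y : Vertex α} (hy : L < y.1.length) : lamps g y = 0 := by
  induction h with
  | one => rfl
  | mul_step h l s l' hx ih =>
    have hnext := (h.mul_step l s l' hx).inv_smul_ne_root hL₀ hL hy
    rw [mul_step_right, mul_inv_rev, mul_smul] at hnext
    rw [lamps_mul_step, ih, Finsupp.single_eq_of_ne (h.inv_smul_ne_root hL₀ hL hy),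
      Finsupp.single_eq_of_ne hnext, add_zero, add_zero]

end Confined

end Bubble

/-! ### Counting confined elements -/

namespace Bubble

open RandomWalk PermWreath

section Ball

variable {α : ℕ → ℕ} {L : ℕ}

/-- The words of length at most `L`. -/
def words : ℕ → Finset (List Bool)
  | 0 => {[]}
  | L + 1 => insert [] ((words L).image (List.cons false) ∪ (words L).image (List.cons true))

theorem mem_words {w : List Bool} : w ∈ words L ↔ w.length ≤ L := by
  induction L generalizing w with
  | zero => simp [words]
  | succ L ih => rcases w with _ | ⟨_ | _, v⟩ <;> simp [words, ih]

theorem card_words_lt (L : ℕ) : (words L).card < 2 ^ (L + 1) := by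
  induction L with
  | zero => simp [words]
  | succ L ih =>
    have hfalse := Finset.card_image_le (s := words L) (f := List.cons false)
    have htrue := Finset.card_image_le (s := words L) (f := List.cons true)
    calc (words (L + 1)).card ≤ _ := Finset.card_insert_le _ _
      _ ≤ _ := Nat.succ_le_succ (Finset.card_union_le _ _)
      _ < 2 ^ (L + 1 + 1) := by omega

/-- The vertices on the cycles indexed by words of length at most `L`. -/
def ball (α : ℕ → ℕ) (L : ℕ) : Finset (Vertex α) :=
  (words L).sigma fun w =>
    (Finset.range (2 * α (w.length + 1))).image fun n : ℕ => (n : ZMod (2 * α (w.length + 1)))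

theorem mem_ball (hα : ∀ k, 1 ≤ k → 1 ≤ α k) {y : Vertex α} :
    y ∈ ball α L ↔ y.1.length ≤ L := by
  rw [ball, Finset.mem_sigma, mem_words, and_iff_left]
  have : NeZero (2 * α (y.1.length + 1)) :=
    ⟨by have := hα (y.1.length + 1) (by omega); omega⟩
  exact Finset.mem_image.2 ⟨y.2.val, Finset.mem_range.2 (ZMod.val_lt y.2),
    ZMod.natCast_zmod_val y.2⟩

theorem card_ball_le {M : ℕ} (hM : ∀ l, l ≤ L → α (l + 1) ≤ M) :
    (ball α L).card ≤ 2 ^ (L + 1) * (2 * M) := by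
  rw [ball, Finset.card_sigma]
  calc _ ≤ ∑ w ∈ words L, 2 * M := Finset.sum_le_sum fun w hw => by
        refine Finset.card_image_le.trans ?_
        rw [Finset.card_range]
        exact Nat.mul_le_mul_left 2 (hM _ (mem_words.1 hw))
    _ = (words L).card * (2 * M) := by rw [Finset.sum_const, smul_eq_mul]
    _ ≤ _ := Nat.mul_le_mul_right _ (card_words_lt L).le

end Ball

section Code

variable {A : Type*} [AddCommGroup A] {α : ℕ → ℕ} {hα : ∀ k, 1 ≤ k → 1 ≤ α k} {m L : ℕ} {x : ℤ}
  {g g' : PermWreath A (Vertex α) (BubbleGroup hα)} {τ τ' : Fin 3 × ℤ → Fin 3 × ℤ}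

open Classical in
/-- The data that, together with the exponent sum of the word, determine a confined element `g`
acting on the tripod by `τ`: its lamps on the ball, its action on the ball (points that leave the
ball are recorded as fixed), and its action on the part of the tripod that can reach an origin. -/
noncomputable def code (m L : ℕ) (g : PermWreath A (Vertex α) (BubbleGroup hα))
    (τ : Fin 3 × ℤ → Fin 3 × ℤ) :
    (ball α L → A) × (ball α L → ball α L) ×
      (Fin 3 × Finset.Icc (-(2 * m) : ℤ) (2 * m) → Fin 3) :=
  (fun y => lamps g y,
    fun y => if h : g.right • y.1 ∈ ball α L then ⟨g.right • y.1, h⟩ else y,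
    fun t => (τ (t.1, t.2)).1)

theorem lamps_eq_of_code_eq (hcode : code m L g τ = code m L g' τ') {y : Vertex α}
    (hy : y.1.length ≤ L) : lamps g y = lamps g' y :=
  congrFun (congrArg Prod.fst hcode) ⟨y, (mem_ball hα).2 hy⟩

theorem smul_eq_smul_of_code_eq (hcode : code m L g τ = code m L g' τ') {y : Vertex α}
    (hy : y.1.length ≤ L) (hg : (g.right • y).1.length ≤ L) (hg' : (g'.right • y).1.length ≤ L) :
    g.right • y = g'.right • y := by
  have := congrFun (congrArg (fun c => c.2.1) hcode) ⟨y, (mem_ball hα).2 hy⟩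
  simp only [code] at this
  rw [dif_pos ((mem_ball hα).2 hg), dif_pos ((mem_ball hα).2 hg')] at this
  exact congrArg Subtype.val this

theorem tripod_fst_eq_of_code_eq (hcode : code m L g τ = code m L g' τ') (j : Fin 3) {i : ℤ}
    (hi : |i| ≤ 2 * m) : (τ (j, i)).1 = (τ' (j, i)).1 :=
  congrFun (congrArg (fun c => c.2.2) hcode) (j, ⟨i, Finset.mem_Icc.2 (abs_le.1 hi)⟩)

namespace Confined

theorem smul_eq_smul_of_shallow (h : Confined hα m x g τ) (h' : Confined hα m x g' τ')
    (hcode : code m L g τ = code m L g' τ') (hL : 4 * m + 1 ≤ α (L + 1)) {y : Vertex α}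
    (hy : Shallow L m x y) : g.right • y = g'.right • y :=
  smul_eq_smul_of_code_eq hcode hy.length_le (h.length_smul_le hL hy) (h'.length_smul_le hL hy)

theorem smul_tripodEmbed_eq (h : Confined hα m x g τ) (h' : Confined hα m x g' τ')
    (hcode : code m L g τ = code m L g' τ') {v : List Bool} (hv : 4 * m + 1 ≤ α (v.length + 1))
    (hv' : 4 * m + 1 ≤ α (v.length + 2)) (j : Fin 3) {i : ℤ} (hi : |i| ≤ 2 * m) :
    g.right • tripodEmbed α v (j, i) = g'.right • tripodEmbed α v (j, i) := by
  have hix : |i + x| ≤ 3 * m := (abs_add_le i x).trans (by have := h.abs_le; omega)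
  have hτ : τ (j, i) = τ' (j, i) :=
    Prod.ext (tripod_fst_eq_of_code_eq hcode j hi) ((h.tripod_snd _).trans (h'.tripod_snd _).symm)
  rw [h.smul_tripodEmbed hv hv' hix, h'.smul_tripodEmbed hv hv' hix, hτ]

theorem smul_eq_smul_near_start (h : Confined hα m x g τ) (h' : Confined hα m x g' τ')
    (hcode : code m L g τ = code m L g' τ') (hL : ∀ l, L ≤ l → 4 * m + 1 ≤ α (l + 1))
    {w : List Bool} (hw : L ≤ w.length) {z : ℤ} (hz : |z| ≤ 2 * m) :
    g.right • (⟨w, (z : ZMod _)⟩ : Vertex α) = g'.right • (⟨w, (z : ZMod _)⟩ : Vertex α) := by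
  rcases hw.eq_or_lt with hw | hw
  · refine h.smul_eq_smul_of_shallow h' hcode (hL L le_rfl)
      (Or.inr ⟨hw.symm, z + x, (abs_add_le z x).trans (by have := h.abs_le; omega), ?_⟩)
    rw [add_sub_cancel_right]
  · rcases w with _ | ⟨c, v⟩
    · simp at hw
    · have hv : L ≤ v.length := Nat.lt_succ_iff.1 hw
      have htripod := fun j => h.smul_tripodEmbed_eq h' hcode (hL _ hv) (hL _ (by omega)) j hz
      cases c with
      | false => exact htripod 1
      | true => exact htripod 2

theorem smul_eq_smul (h : Confined hα m x g τ) (h' : Confined hα m x g' τ')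
    (hcode : code m L g τ = code m L g' τ') (hL : ∀ l, L ≤ l → 4 * m + 1 ≤ α (l + 1))
    (y : Vertex α) : g.right • y = g'.right • y := by
  obtain ⟨w, i⟩ := y
  rcases lt_or_ge w.length L with hw | hw
  · exact h.smul_eq_smul_of_shallow h' hcode (hL L le_rfl) (Or.inl hw)
  by_cases hmiddle : ∃ z : ℤ, |z| ≤ 2 * m ∧ i = (α (w.length + 1) : ZMod _) + (z : ZMod _)
  · obtain ⟨z, hz, rfl⟩ := hmiddle
    exact h.smul_tripodEmbed_eq h' hcode (hL _ hw) (hL _ (by omega)) 0 hz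
  by_cases hstart : ∃ z : ℤ, |z| ≤ 2 * m ∧ i = (z : ZMod _)
  · obtain ⟨z, hz, rfl⟩ := hstart
    exact h.smul_eq_smul_near_start h' hcode hL hw hz
  push Not at hmiddle hstart
  have hbound (z : ℤ) (hz : |z| ≤ m) : |-(x + z)| ≤ 2 * m := by
    rw [abs_neg]
    exact (abs_add_le x z).trans (by have := h.abs_le; omega)
  have hstart' (z : ℤ) (hz : |z| ≤ m) : i + ((x + z : ℤ) : ZMod _) ≠ 0 := fun e =>
    hstart _ (hbound z hz) (by rw [Int.cast_neg]; exact eq_neg_of_add_eq_zero_left e)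
  have hmiddle' (z : ℤ) (hz : |z| ≤ m) :
      i + ((x + z : ℤ) : ZMod _) ≠ (α (w.length + 1) : ZMod _) := fun e =>
    hmiddle _ (hbound z hz) (by rw [Int.cast_neg, ← e, add_neg_cancel_right])
  rw [h.smul_of_far w i hstart' hmiddle', h'.smul_of_far w i hstart' hmiddle']

theorem eq_of_code_eq (h : Confined hα m x g τ) (h' : Confined hα m x g' τ')
    (hcode : code m L g τ = code m L g' τ') (hL₀ : 0 < L)
    (hL : ∀ l, L ≤ l → 4 * m + 1 ≤ α (l + 1)) : g = g' := by
  refine SemidirectProduct.ext (Multiplicative.toAdd.injective (Finsupp.ext fun y => ?_))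
    (Subtype.ext (Equiv.ext (h.smul_eq_smul h' hcode hL)))
  rcases le_or_gt y.1.length L with hy | hy
  · exact lamps_eq_of_code_eq hcode hy
  · exact (h.lamps_eq_zero hL₀ (hL L le_rfl) hy).trans
      (h'.lamps_eq_zero hL₀ (hL L le_rfl) hy).symm

end Confined

/-- The number of pairs of an exponent sum and a `code`, for lamps with `q` states. -/
def codeCard (q : ℕ) (α : ℕ → ℕ) (m L : ℕ) : ℕ :=
  (2 * m + 1) * (q ^ (ball α L).card * ((ball α L).card ^ (ball α L).card *
    3 ^ (3 * (4 * m + 1))))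

theorem confinedSet_finite_and_ncard_le [Fintype A] (hL₀ : 0 < L)
    (hL : ∀ l, L ≤ l → 4 * m + 1 ≤ α (l + 1)) :
    (confinedSet hα A m).Finite ∧
      (confinedSet hα A m).ncard ≤ codeCard (Fintype.card A) α m L := by
  classical
  choose x τ hconfined using fun g : confinedSet hα A m => g.2
  let toCode (g : confinedSet hα A m) :=
    ((⟨x g, Finset.mem_Icc.2 (abs_le.1 (hconfined g).abs_le)⟩ : Finset.Icc (-m : ℤ) m),
      code m L g.1 (τ g))
  have hinj : Function.Injective toCode := by
    intro g g' h
    simp only [toCode, Prod.mk.injEq, Subtype.mk.injEq] at h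
    exact Subtype.ext ((hconfined g).eq_of_code_eq (h.1 ▸ hconfined g') h.2 hL₀ hL)
  refine ⟨Finite.of_injective toCode hinj, (Nat.card_le_card_of_injective toCode hinj).trans_eq ?_⟩
  have hexp : ((m : ℤ) + 1 - -m).toNat = 2 * m + 1 := by omega
  have htripod : ((2 * m : ℤ) + 1 - -(2 * m)).toNat = 4 * m + 1 := by omega
  simp only [Nat.card_eq_fintype_card, Fintype.card_prod, Fintype.card_fun, Fintype.card_coe,
    Int.card_Icc, Fintype.card_fin, codeCard, hexp, htripod]

end Code

/-! ### The probability of confinement -/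

section Confinement

variable {A : Type*} [AddCommGroup A] {α : ℕ → ℕ} {hα : ∀ k, 1 ≤ k → 1 ≤ α k} {m L : ℕ} {x : ℤ}
  {g : PermWreath A (Vertex α) (BubbleGroup hα)} {τ : Fin 3 × ℤ → Fin 3 × ℤ} {θ : ℝ}

theorem mean_cos_add_exponent (θ : ℝ) (x : ℤ) :
    mean (PMF.uniformOfFintype (Fin 4)) (fun s => Real.cos (θ * (x + exponent s : ℤ))) =
      (1 + Real.cos θ) / 2 * Real.cos (θ * x) := by
  rw [mean_uniformOfFintype]
  simp only [Fin.sum_univ_four, exponent, Matrix.cons_val_zero, Matrix.cons_val_one,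
    Matrix.cons_val, Int.cast_add, Int.cast_neg, Int.cast_one, Int.cast_zero, mul_add,
    Real.cos_add, mul_neg, mul_one, Real.cos_neg, Real.sin_neg, mul_zero, Real.cos_zero,
    Real.sin_zero, Fintype.card_fin, Nat.cast_ofNat]
  ring

theorem cos_mul_eq_zero_of_abs_eq (hθ : θ * (m + 1) = Real.pi / 2) (hx : |x| = m + 1) :
    Real.cos (θ * x) = 0 := by
  have hx' : |(x : ℝ)| = |(m : ℝ) + 1| := by
    rw [← Int.cast_abs, hx, abs_of_nonneg (by positivity)]
    push_cast
    rfl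
  rw [← Real.cos_abs, abs_mul, hx', ← abs_mul, hθ, Real.cos_abs, Real.cos_pi_div_two]

-- `cos (θ x)` is the ground state of the exponent walk killed outside `[-m, m]`.
theorem Confined.pow_mul_cos_le (ν : PMF A) [Finite ν.support]
    (hθ : θ * (m + 1) = Real.pi / 2) (n : ℕ) (h : Confined hα m x g τ) :
    ((1 + Real.cos θ) / 2) ^ n * Real.cos (θ * x) ≤
      mean (law (switchWalkSwitch (root α) ν (simpleStep hα)) n)
        fun k => (confinedSet hα A m).indicator 1 (g * k) := by
  induction n generalizing x g τ with
  | zero =>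
    have hg : g ∈ confinedSet hα A m := ⟨x, τ, h⟩
    simpa [law_zero, mean_pure, hg] using Real.cos_le_one _
  | succ n ih =>
    have hstep (l : A) (s : Fin 4) (l' : A) :
        ((1 + Real.cos θ) / 2) ^ n * Real.cos (θ * (x + exponent s : ℤ)) ≤
          mean (law (switchWalkSwitch (root α) ν (simpleStep hα)) n) fun k =>
            (confinedSet hα A m).indicator 1 (g * (step (root α) l (letter hα s) l' * k)) := by
      simp only [← mul_assoc g]
      by_cases hx : |x + exponent s| ≤ m
      · exact ih (h.mul_step l s l' hx)
      · have hexit : |x + exponent s| = m + 1 := by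
          have := (abs_add_le x (exponent s)).trans
            (add_le_add h.abs_le (abs_exponent_le_one s))
          omega
        rw [cos_mul_eq_zero_of_abs_eq hθ hexit, mul_zero, ← mean_const _ 0]
        exact mean_mono fun k => Set.indicator_nonneg (fun _ _ => zero_le_one) _
    calc ((1 + Real.cos θ) / 2) ^ (n + 1) * Real.cos (θ * x)
        = mean ν fun _ => mean (PMF.uniformOfFintype (Fin 4)) fun s => mean ν fun _ =>
            ((1 + Real.cos θ) / 2) ^ n * Real.cos (θ * (x + exponent s : ℤ)) := by
          simp only [mean_const, mean_const_mul, mean_cos_add_exponent, pow_succ, mul_assoc]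
      _ ≤ _ := by
          rw [mean_law_succ', mean_switchWalkSwitch]
          simp only [mean_simpleStep_eq_mean_letter]
          exact mean_mono fun l => mean_mono fun s => mean_mono fun l' => hstep l s l'

theorem pow_le_mean_indicator_confinedSet (hα : ∀ k, 1 ≤ k → 1 ≤ α k) (m : ℕ) (ν : PMF A)
    [Finite ν.support] (n : ℕ) :
    ((1 + Real.cos (Real.pi / 2 / (m + 1))) / 2) ^ n ≤
      mean (law (switchWalkSwitch (root α) ν (simpleStep hα)) n)
        ((confinedSet hα A m).indicator 1) := by
  have hθ : Real.pi / 2 / (m + 1) * (m + 1) = Real.pi / 2 := by field_simp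
  simpa using (Confined.one (A := A) (hα := hα) (m := m)).pow_mul_cos_le ν hθ n

theorem one_sub_le_one_add_cos_div_two (m : ℕ) :
    1 - 1 / ((m : ℝ) + 1) ^ 2 ≤ (1 + Real.cos (Real.pi / 2 / (m + 1))) / 2 := by
  have hcos := Real.one_sub_sq_div_two_le_cos (x := Real.pi / 2 / (m + 1))
  have hangle : (Real.pi / 2 / ((m : ℝ) + 1)) ^ 2 ≤ 4 / (m + 1) ^ 2 := by
    rw [div_pow]
    gcongr
    nlinarith [Real.pi_pos, Real.pi_lt_four]
  have : 4 / ((m : ℝ) + 1) ^ 2 = 4 * (1 / (m + 1) ^ 2) := by ring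
  linarith

theorem half_le_one_add_cos_div_two (m : ℕ) :
    1 / 2 ≤ (1 + Real.cos (Real.pi / 2 / (m + 1))) / 2 := by
  have hangle : Real.pi / 2 / ((m : ℝ) + 1) ≤ Real.pi / 2 :=
    div_le_self (by positivity) (by simp)
  have hangle₀ : 0 ≤ Real.pi / 2 / ((m : ℝ) + 1) := by positivity
  have := Real.cos_nonneg_of_neg_pi_div_two_le_of_le (by linarith) hangle
  linarith

theorem neg_div_sq_le_log_one_add_cos_div_two (m : ℕ) :
    -(2 / ((m : ℝ) + 1) ^ 2) ≤ Real.log ((1 + Real.cos (Real.pi / 2 / (m + 1))) / 2) := by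
  have hlower := one_sub_le_one_add_cos_div_two m
  have hhalf := half_le_one_add_cos_div_two m
  set c := (1 + Real.cos (Real.pi / 2 / (m + 1))) / 2
  have hc : 0 < c := by linarith
  have hinv : c⁻¹ ≤ 2 := inv_le_of_inv_le₀ two_pos (by linarith)
  calc -(2 / ((m : ℝ) + 1) ^ 2) = -(1 / (m + 1) ^ 2 * 2) := by ring
    _ ≤ -((1 - c) * c⁻¹) := by gcongr; linarith
    _ = 1 - c⁻¹ := by field_simp; ring
    _ ≤ Real.log c := Real.one_sub_inv_le_log_of_pos hc

theorem abs_log_returnProb_le [Fintype A] (hα : ∀ k, 1 ≤ k → 1 ≤ α k) (hL₀ : 0 < L)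
    (hL : ∀ l, L ≤ l → 4 * m + 1 ≤ α (l + 1)) {ν : PMF A} (hν : ν.map (fun l => -l) = ν) (n : ℕ) :
    |Real.log (returnProb (switchWalkSwitch (root α) ν (simpleStep hα)) (2 * n))| ≤
      Real.log (codeCard (Fintype.card A) α m L) + 4 * n / (m + 1) ^ 2 := by
  set c := (1 + Real.cos (Real.pi / 2 / (m + 1))) / 2
  have hc : 0 < c := one_half_pos.trans_le (half_le_one_add_cos_div_two m)
  obtain ⟨hfin, hcard⟩ := confinedSet_finite_and_ncard_le (A := A) (hα := hα) hL₀ hL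
  have hne : (confinedSet hα A m).Nonempty := ⟨1, 0, id, Confined.one⟩
  calc _ ≤ Real.log (confinedSet hα A m).ncard - 2 * Real.log (c ^ n) :=
        RandomWalk.abs_log_returnProb_le
          (map_inv_switchWalkSwitch _ hν (map_inv_simpleStep hα)) n hfin (pow_pos hc n)
          (pow_le_mean_indicator_confinedSet hα m ν n)
    _ ≤ Real.log (codeCard (Fintype.card A) α m L) - 2 * (n * -(2 / (m + 1) ^ 2)) := by
        rw [Real.log_pow]
        have hpos : 0 < ((confinedSet hα A m).ncard : ℝ) := by
          exact_mod_cast hne.ncard_pos hfin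
        gcongr
        exact neg_div_sq_le_log_one_add_cos_div_two m
    _ = _ := by ring

end Confinement

end Bubble

/-! ### The scaling sequence -/

namespace Bubble

open RandomWalk PermWreath

section Scaling

theorem scaling_le_two_pow {k : ℕ} (hk : 1 ≤ k) : scaling k ≤ 2 ^ k := by
  refine Nat.ceil_le.2 ?_
  push_cast
  exact div_le_self (by positivity) (one_le_pow₀ (by exact_mod_cast hk))

theorem two_pow_div_sq_le_scaling (k : ℕ) : (2 : ℝ) ^ k / (k : ℝ) ^ 2 ≤ scaling k := by
  have h : (2 : ℚ) ^ k / (k : ℚ) ^ 2 ≤ scaling k := Nat.le_ceil _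
  simpa using (Rat.cast_le (K := ℝ)).2 h

theorem scaling_le_two_pow_div_sq_add_one (k : ℕ) :
    (scaling k : ℝ) ≤ (2 : ℝ) ^ k / (k : ℝ) ^ 2 + 1 := by
  have h : (scaling k : ℚ) ≤ (2 : ℚ) ^ k / (k : ℚ) ^ 2 + 1 :=
    (Nat.ceil_lt_add_one (by positivity)).le
  simpa using (Rat.cast_le (K := ℝ)).2 h

theorem two_pow_div_sq_mono {k l : ℕ} (hk : 3 ≤ k) (hkl : k ≤ l) :
    (2 : ℝ) ^ k / (k : ℝ) ^ 2 ≤ (2 : ℝ) ^ l / (l : ℝ) ^ 2 := by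
  induction l, hkl using Nat.le_induction with
  | base => exact le_rfl
  | succ l hl ih =>
    refine ih.trans ?_
    have hl' : (3 : ℝ) ≤ l := by exact_mod_cast hk.trans hl
    rw [div_le_div_iff₀ (by positivity) (by positivity), pow_succ 2 l, mul_assoc]
    push_cast
    gcongr
    nlinarith

theorem summable_scaling_div_two_pow :
    Summable fun k : ℕ => (scaling (k + 1) : ℝ) / 2 ^ (k + 1) := by
  have hsum : Summable fun k : ℕ => 1 / (k : ℝ) ^ 2 + (1 / 2 : ℝ) ^ k :=
    (Real.summable_one_div_nat_pow.2 one_lt_two).add summable_geometric_two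
  refine (summable_nat_add_iff (f := fun k => (scaling k : ℝ) / 2 ^ k) 1).2
    (hsum.of_nonneg_of_le (fun k => by positivity) fun k => ?_)
  calc (scaling k : ℝ) / 2 ^ k ≤ (2 ^ k / (k : ℝ) ^ 2 + 1) / 2 ^ k := by
        gcongr
        exact scaling_le_two_pow_div_sq_add_one k
    _ = 1 / (k : ℝ) ^ 2 + (1 / 2) ^ k := by
        rw [one_div_pow, add_div, div_right_comm, div_self (by positivity)]

/-- The half-width of the window to which the exponent sum is confined at the scale of level `k`.
The factor `5` leaves room for `4 * bandwidth k + 1 ≤ α_k`. -/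
noncomputable def bandwidth (k : ℕ) : ℕ := ⌊(2 : ℝ) ^ k / (k : ℝ) ^ 2 / 5⌋₊

theorem bandwidth_le (k : ℕ) : (bandwidth k : ℝ) ≤ 2 ^ k / (k : ℝ) ^ 2 / 5 :=
  Nat.floor_le (by positivity)

theorem bandwidth_le_two_pow {k : ℕ} (hk : 1 ≤ k) : (bandwidth k : ℝ) ≤ 2 ^ k := by
  have hk' : (1 : ℝ) ≤ k := by exact_mod_cast hk
  calc (bandwidth k : ℝ) ≤ 2 ^ k / ((k : ℝ) ^ 2 * 5) := (bandwidth_le k).trans_eq (div_div _ _ _)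
    _ ≤ 2 ^ k := div_le_self (by positivity) (by nlinarith)

theorem four_mul_bandwidth_add_one_le_scaling {k l : ℕ} (hk : 3 ≤ k) (hkl : k ≤ l) :
    4 * bandwidth k + 1 ≤ scaling l := by
  have hfive : (5 * bandwidth k : ℝ) ≤ scaling l := by
    linarith [bandwidth_le k, two_pow_div_sq_mono hk hkl, two_pow_div_sq_le_scaling l]
  have hfive' : 5 * bandwidth k ≤ scaling l := by exact_mod_cast hfive
  have hone := one_le_scaling l (by omega)
  omega

theorem four_mul_div_bandwidth_sq_le {k n : ℕ} (hk : 1 ≤ k) (hn : n ≤ 16 ^ k) :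
    4 * (n : ℝ) / (bandwidth k + 1) ^ 2 ≤ 100 * (4 ^ k * (k : ℝ) ^ 4) := by
  have hn' : (n : ℝ) ≤ 16 ^ k := by exact_mod_cast hn
  have hfloor : (2 : ℝ) ^ k / (k : ℝ) ^ 2 / 5 ≤ bandwidth k + 1 := (Nat.lt_floor_add_one _).le
  have hpow : (16 : ℝ) ^ k = 4 ^ k * (2 ^ k * 2 ^ k) := by
    rw [← mul_pow, ← mul_pow]
    norm_num
  calc 4 * (n : ℝ) / (bandwidth k + 1) ^ 2 ≤ 4 * 16 ^ k / (2 ^ k / (k : ℝ) ^ 2 / 5) ^ 2 := by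
        gcongr
    _ = 100 * (4 ^ k * (k : ℝ) ^ 4) := by
        rw [hpow]
        field_simp
        norm_num

end Scaling

/-! ### The return probability -/

section ReturnProbability

theorem log_codeCard_le {q : ℕ} {α : ℕ → ℕ} {m L : ℕ} (hq : 0 < q)
    (hball : 0 < (ball α L).card) :
    Real.log (codeCard q α m L) ≤
      26 * m + 6 + (ball α L).card * (Real.log q + Real.log (ball α L).card) := by
  set b := (ball α L).card
  have hlogm : Real.log (2 * m + 1) ≤ 2 * m := by
    linarith [Real.log_le_sub_one_of_pos (show (0 : ℝ) < 2 * m + 1 by positivity)]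
  have hlog3 : Real.log 3 ≤ 2 := by
    linarith [Real.log_le_sub_one_of_pos (show (0 : ℝ) < 3 by norm_num)]
  calc Real.log (codeCard q α m L)
      = Real.log (2 * m + 1) +
          (b * Real.log q + (b * Real.log b + (3 * (4 * m + 1)) * Real.log 3)) := by
        rw [codeCard]
        push_cast
        rw [Real.log_mul (by positivity) (by positivity),
          Real.log_mul (by positivity) (by positivity),
          Real.log_mul (by positivity) (by positivity), Real.log_pow, Real.log_pow, Real.log_pow]
        push_cast
        rfl
    _ ≤ 2 * m + (b * Real.log q + (b * Real.log b + (3 * (4 * m + 1)) * 2)) := by gcongr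
    _ = 26 * m + 6 + b * (Real.log q + Real.log b) := by ring

theorem card_ball_scaling_le (L : ℕ) : (ball scaling L).card ≤ 2 * 4 ^ (L + 1) := by
  calc (ball scaling L).card ≤ 2 ^ (L + 1) * (2 * 2 ^ (L + 1)) :=
        card_ball_le fun l hl => (scaling_le_two_pow (by omega)).trans
          (Nat.pow_le_pow_right two_pos (by omega))
    _ = 2 * 4 ^ (L + 1) := by
        rw [show (4 : ℕ) = 2 * 2 by norm_num, mul_pow]
        ring

theorem card_ball_scaling_pos (L : ℕ) : 0 < (ball scaling L).card :=
  Finset.card_pos.2 ⟨root scaling, (mem_ball one_le_scaling).2 (Nat.zero_le _)⟩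

theorem log_card_ball_scaling_le (L : ℕ) :
    Real.log (ball scaling L).card ≤ 1 + 2 * (L + 1 : ℕ) := by
  have hpos : (0 : ℝ) < (ball scaling L).card := by exact_mod_cast card_ball_scaling_pos L
  have hlog2 : Real.log 2 ≤ 1 := by linarith [Real.log_two_lt_d9]
  calc Real.log (ball scaling L).card ≤ Real.log (2 ^ (1 + 2 * (L + 1))) := by
        refine Real.log_le_log hpos ?_
        rw [pow_add, pow_mul]
        norm_num
        exact_mod_cast card_ball_scaling_le L
    _ = (1 + 2 * (L + 1 : ℕ)) * Real.log 2 := by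
        rw [Real.log_pow]
        push_cast
        rfl
    _ ≤ 1 + 2 * (L + 1 : ℕ) := mul_le_of_le_one_right (by positivity) hlog2

theorem log_codeCard_scaling_le {q : ℕ} (hq : 0 < q) (L : ℕ) :
    Real.log (codeCard q scaling (bandwidth (L + 1)) L) ≤
      (2 * Real.log q + 38) * (4 ^ (L + 1) * (L + 1 : ℕ)) := by
  set k := L + 1
  have hk : (1 : ℝ) ≤ k := by exact_mod_cast Nat.succ_pos L
  have hN : (1 : ℝ) ≤ 4 ^ k := one_le_pow₀ (by norm_num)
  have hm : (bandwidth k : ℝ) ≤ 4 ^ k :=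
    (bandwidth_le_two_pow (Nat.succ_pos L)).trans (by gcongr; norm_num)
  have hball : ((ball scaling L).card : ℝ) ≤ 2 * 4 ^ k := by
    exact_mod_cast card_ball_scaling_le L
  calc _ ≤ 26 * (bandwidth k : ℝ) + 6 +
          (ball scaling L).card * (Real.log q + Real.log (ball scaling L).card) :=
        log_codeCard_le hq (card_ball_scaling_pos L)
    _ ≤ 26 * 4 ^ k + 6 * 4 ^ k + 2 * 4 ^ k * (Real.log q + (1 + 2 * k)) := by
        have := log_card_ball_scaling_le L
        gcongr
        linarith
    _ = 4 ^ k * ((2 * Real.log q + 34) * 1 + 4 * k) := by ring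
    _ ≤ 4 ^ k * ((2 * Real.log q + 34) * k + 4 * k) := by gcongr
    _ = _ := by ring

variable {A : Type*} [AddCommGroup A] [Fintype A] {ν : PMF A}

theorem abs_log_returnProb_scaling_le (hν : ν.map (fun l => -l) = ν) {L n : ℕ} (hL : 2 ≤ L)
    (hn : n ≤ 16 ^ (L + 1)) :
    |Real.log (returnProb
        (switchWalkSwitch (root scaling) ν (simpleStep one_le_scaling)) (2 * n))| ≤
      (2 * Real.log (Fintype.card A) + 138) * (4 ^ (L + 1) * (L + 1 : ℕ) ^ 4) := by
  have hcode := log_codeCard_scaling_le (Fintype.card_pos (α := A)) L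
  have hwalk := four_mul_div_bandwidth_sq_le (Nat.succ_pos L) hn
  have hpow : ((L + 1 : ℕ) : ℝ) ≤ (L + 1 : ℕ) ^ 4 :=
    le_self_pow₀ (by exact_mod_cast Nat.succ_pos L) (by norm_num)
  calc _ ≤ Real.log (codeCard (Fintype.card A) scaling (bandwidth (L + 1)) L) +
          4 * n / (bandwidth (L + 1) + 1) ^ 2 :=
        abs_log_returnProb_le one_le_scaling (by omega)
          (fun l hl => four_mul_bandwidth_add_one_le_scaling (by omega) (by omega)) hν n
    _ ≤ (2 * Real.log (Fintype.card A) + 38) * (4 ^ (L + 1) * (L + 1 : ℕ) ^ 4) +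
          100 * (4 ^ (L + 1) * (L + 1 : ℕ) ^ 4) := by
        refine add_le_add (hcode.trans ?_) hwalk
        gcongr
    _ = _ := by ring

theorem abs_log_returnProb_scaling_le_sqrt (hν : ν.map (fun l => -l) = ν) {n : ℕ}
    (hn : 16 ^ 2 ≤ n) :
    |Real.log (returnProb
        (switchWalkSwitch (root scaling) ν (simpleStep one_le_scaling)) (2 * n))| ≤
      (2 * Real.log (Fintype.card A) + 138) * 4 * ((n : ℝ) ^ (1 / 2 : ℝ) * Real.log n ^ 4) := by
  set L := Nat.log 16 n
  have hn₀ : n ≠ 0 := by rintro rfl; norm_num at hn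
  have hL : 2 ≤ L := (Nat.le_log_iff_pow_le (by norm_num) hn₀).2 hn
  have hL' : (2 : ℝ) ≤ L := by exact_mod_cast hL
  have hLn : (16 : ℝ) ^ L ≤ n := by exact_mod_cast Nat.pow_log_le_self 16 hn₀
  have hsqrt : (4 : ℝ) ^ L ≤ (n : ℝ) ^ (1 / 2 : ℝ) := by
    rw [← Real.sqrt_eq_rpow]
    refine Real.le_sqrt_of_sq_le ?_
    rw [← pow_mul, mul_comm, pow_mul]
    norm_num
    exact hLn
  have hlog : ((L + 1 : ℕ) : ℝ) ≤ Real.log n := by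
    have hle := Real.log_le_log (by positivity) hLn
    rw [Real.log_pow, show (16 : ℝ) = 2 ^ 4 by norm_num, Real.log_pow] at hle
    push_cast at hle ⊢
    nlinarith [Real.log_two_gt_d9]
  calc _ ≤ (2 * Real.log (Fintype.card A) + 138) * (4 ^ (L + 1) * (L + 1 : ℕ) ^ 4) :=
        abs_log_returnProb_scaling_le hν hL (Nat.lt_pow_succ_log_self (by norm_num) n).le
    _ = (2 * Real.log (Fintype.card A) + 138) * 4 * (4 ^ L * (L + 1 : ℕ) ^ 4) := by ring
    _ ≤ _ := by gcongr

theorem upperReturnExponent_scaling_le {A : Type*} [AddCommGroup A] [Finite A] {ν : PMF A}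
    (hν : ν.map (fun l => -l) = ν) :
    upperReturnExponent (switchWalkSwitch (root scaling) ν (simpleStep one_le_scaling)) ≤
      ((1 / 2 : ℝ) : EReal) := by
  have := Fintype.ofFinite A
  exact upperReturnExponent_le (by norm_num) <|
    (Filter.eventually_ge_atTop (16 ^ 2)).mono fun _ hn => abs_log_returnProb_scaling_le_sqrt hν hn

end ReturnProbability

end Bubble

open Bubble PermWreath RandomWalk in
theorem theorem1_general (A : Type*) [AddCommGroup A] [Fintype A] [Nontrivial A]
    (μ : PMF (PermWreath A S Γ))
    (hμ : μ = switchWalkSwitch (root scaling) (PMF.uniformOfFintype A)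
      (simpleStep one_le_scaling)) :
    Group.FG (PermWreath A S Γ) ∧
      (∀ g, μ g⁻¹ = μ g) ∧
      μ.support.Finite ∧
      Subgroup.closure μ.support = ⊤ ∧
      ¬ Liouville μ ∧
      PositiveSpeed μ ∧
      upperReturnExponent μ ≤ ((1 / 2 : ℝ) : EReal) := by
  subst hμ
  have hneg : (PMF.uniformOfFintype A).map (fun l => -l) = PMF.uniformOfFintype A :=
    map_equiv_uniformOfFintype (Equiv.neg A)
  have hfinite := Set.toFinite (switchWalkSwitch (root scaling) (PMF.uniformOfFintype A)
    (simpleStep one_le_scaling)).support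
  have hclosure := closure_support_switchWalkSwitch (o := root scaling)
    (PMF.support_uniformOfFintype A) (closure_support_simpleStep one_le_scaling)
  have hescape := isEscapePotential_potential one_le_scaling summable_scaling_div_two_pow
  exact ⟨Group.fg_iff.2 ⟨_, hclosure, hfinite⟩,
    map_inv_eq_self_iff.1 (map_inv_switchWalkSwitch _ hneg (map_inv_simpleStep _)),
    hfinite, hclosure, hescape.not_liouville, hescape.positiveSpeed,
    upperReturnExponent_scaling_le hneg⟩

theorem theorem1 :
    Group.FG Bubble.G ∧
      (∀ g : Bubble.G, Bubble.stepLaw g⁻¹ = Bubble.stepLaw g) ∧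
      Bubble.stepLaw.support.Finite ∧
      Subgroup.closure Bubble.stepLaw.support = ⊤ ∧
      ¬ RandomWalk.Liouville Bubble.stepLaw ∧
      RandomWalk.PositiveSpeed Bubble.stepLaw ∧
      RandomWalk.upperReturnExponent Bubble.stepLaw ≤ ((1 / 2 : ℝ) : EReal) :=
  theorem1_general (ZMod 2) Bubble.stepLaw rfl
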